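/- Let $\alpha\in[0,1)$. Put $\alpha_0=\alpha$ and $\alpha_k=\{1/\alpha_{k-1}\}$ as long as $\alpha_{k-1}\neq0$. If $\alpha$ is irrational, let $r=\infty$; if $\alpha$ is rational, let $r$ be the least $k$ with $\alpha_k=0$. For $1\le k\le r$ (with $k$ finite) let $a_k=\lceil 1/\alpha_{k-1}\rceil-1$; thus $\alpha=[0,a_1,a_2,\dots]$ for irrational $\alpha$, and $\alpha=[0,a_1,\dots,a_r,1]$ for rational $\alpha\ne 0$. Let $p_k/q_k=[0,a_1,\dots,a_k]$, in lowest terms. A sequence $d=(d_j)_{j\ge1}$ of nonnegative integers (with $d_j=0$ for $j>r$) is called $\alpha$-admissible if, for all $j\le r$, $0\le d_j\le a_j$, and $d_j=0$ implies that $d_i=0$ for all $i\ge j$ or that $j\geq 2$ and $d_{j-1}=a_{j-1}$, and if, for irrational $\alpha$, $d$ does not end in $a_k,0,a_{k+2},0,a_{k+4},0,\dots$. The $\alpha$-numeration of a nonnegative integer $\nu$ is the $\alpha$-admissible sequence $n$ which is eventually zero and satisfies $\nu=\sum_{j\ge1}n_jq_{j-1}$; the $\alpha$-numeration of a real $\beta\in[0,1)$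 is the $\alpha$-admissible sequence $b$ with $\beta=\sum_{j\ge1}b_j(q_{j-1}\alpha-p_{j-1})$. (For irrational $\alpha$ all $\nu$ and $\beta$ have one; for rational $\alpha=p/q$ in lowest terms exactly the $\nu<q$ and the $\beta\in\{0,1/q,\dots,(q-1)/q\}$ have one.) Write $\sigma^i(d)=(d_{i+1},d_{i+2},\dots)$ and $(0)$ for the null sequence. Write $d<_Rd'$ if there is a $j\geq 1$ with $d_j<d'_j$ and $d_i=d'_i$ for all $i>j$, and $d<_Ad'$ if there is a $j\geq 1$ with $(-1)^{j-1}d_j<(-1)^{j-1}d'_j$ and $d_i=d'_i$ for all $i<j$. **Proposition.** Let $\nu$ be a positive integer and $\beta\in[0,1)$; if $\alpha=p/q$ is rational (in lowest terms), suppose that $\nu<q$ and $\beta\in\{\{k\alpha\}:k\in\mathbb N\}$. Let $n$ and $b$ be the $\alpha$-numerations of $\nu$ and $\beta$, and let $s$ be the minimum of the lengths of $n$ and $b$, where the length of a sequence is counted without its infinite tail of zeros, and is infinite if there is no such tail. Let $\nu_0=\nu$ and, for $1\le k\le s$, $$\nu_k=\begin{cases}\lfloor\nu_{k-1}\alpha_{k-1}\rfloor&\text{if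 } n_{k+1}\neq0\text{ or }\sigma^k(n)=(0),\\ \lfloor\nu_{k-1}\alpha_{k-1}\rfloor+1&\text{otherwise.}\end{cases}$$ Then $C(\alpha,\beta,\nu)=\#\{k\in\{0,\dots,\nu-1\}:\{k\alpha\}<\beta\}$ satisfies $$C(\alpha,\beta,\nu)=\sum_{i=1}^{s}(-1)^{i-1}\left[b_i\nu_i+\tau_i+\varepsilon_i-\varepsilon'_i\right],$$ where $\tau_i=1$ if $n_in_{i+1}=0$ and $\sigma^i(n)\neq(0)$, and $\tau_i=\min(b_i,n_i)$ otherwise; $\varepsilon_i=1$ if $b_i<n_i$ and $\sigma^i(b)<_A\sigma^i(n)$, and $\varepsilon_i=0$ otherwise; $\varepsilon'_i=1$ if $\sigma^i(b)<_R\sigma^i(n)$, and $\varepsilon'_i=0$ otherwise. -/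

import Mathlib

namespace AlphaNumeration

/-! All sequences of digits are indexed from `0`: the term usually written `d₁` is `d 0`, the term
`d_{i+1}` is `d i`. Finite sequences are extended by zeros. -/

/-- The iterates of the Gauss map: `α₀ = α` and `α_k = {1 / α_{k-1}}`. For irrational `α` no iterate
vanishes; for rational `α = [0, a₁, …, a_r, 1]` the first iterate that vanishes is `α_r`
(and then all later ones are `0`, as `1 / 0 = 0` in Lean). -/
noncomputable def gaussIter (α : ℝ) : ℕ → ℝ
  | 0 => α
  | k + 1 => Int.fract (1 / gaussIter α k)

/-- The partial quotient `a_{i+1}` of `α ∈ [0, 1)`, where the expansion of a rational number is the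
one which ends in `1`: `α = [0, a₁, …, a_r, 1]`. For `i + 1 ≤ r` (that is, `α_i ≠ 0`) it equals
`⌈1 / α_i⌉ - 1`, which is `⌊1 / α_i⌋` unless `1 / α_i` is an integer; the latter only happens for
rational `α` and `i + 1 = r`, where `α_i = [0, a_r, 1] = 1 / (a_r + 1)`. For rational `α` and
`i + 1 > r` we put the value `0`, so that digit sequences of `ℕ^r`, extended by zeros, are the
sequences dominated by the partial quotients. -/
noncomputable def quot (α : ℝ) (i : ℕ) : ℕ :=
  open Classical in
  if gaussIter α i = 0 then 0 else (⌈1 / gaussIter α i⌉ - 1).toNat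

/-- The numerator `p_i` of the convergent `[0, a₁, …, a_i]`. -/
noncomputable def convNum (α : ℝ) : ℕ → ℕ
  | 0 => 0
  | 1 => 1
  | i + 2 => quot α (i + 1) * convNum α (i + 1) + convNum α i

/-- The denominator `q_i` of the convergent `[0, a₁, …, a_i]`. -/
noncomputable def convDen (α : ℝ) : ℕ → ℕ
  | 0 => 1
  | 1 => quot α 0
  | i + 2 => quot α (i + 1) * convDen α (i + 1) + convDen α i

/-- The null sequence. -/
def IsNull (d : ℕ → ℕ) : Prop := ∀ i, d i = 0

/-- `σ^k (d) = (d_{k+1}, d_{k+2}, …)`. -/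
def shift (k : ℕ) (d : ℕ → ℕ) : ℕ → ℕ := fun i => d (k + i)

/-- The length of `d` when the infinite tail of zeros, if there is one, is dropped
(`⊤` if there is none). -/
noncomputable def seqLength (d : ℕ → ℕ) : ℕ∞ :=
  sInf {m : ℕ∞ | ∀ i : ℕ, m ≤ (i : ℕ∞) → d i = 0}

/-- The set `E_α` of `α`-admissible sequences. For irrational `α` the sequence must not end in
`a_k, 0, a_{k+2}, 0, …`. -/
structure IsAdmissible (α : ℝ) (d : ℕ → ℕ) : Prop where
  le_quot : ∀ i, d i ≤ quot α i
  eq_zero : ∀ i, d i = 0 → (∀ j, i ≤ j → d j = 0) ∨ (∃ k, i = k + 1 ∧ d k = quot α k)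
  not_tail : Irrational α →
    ¬ ∃ m, ∀ t, d (m + 2 * t) = quot α (m + 2 * t) ∧ d (m + 2 * t + 1) = 0

/-- `n` is the `α`-numeration of the integer `ν`: an `α`-admissible sequence which ends in zeros,
with `ν = ∑_{j ≥ 1} n_j q_{j-1}`. -/
def IsIntNumeration (α : ℝ) (n : ℕ → ℕ) (ν : ℕ) : Prop :=
  IsAdmissible α n ∧
    ∃ L, (∀ i, L ≤ i → n i = 0) ∧ ν = ∑ i ∈ Finset.range L, n i * convDen α i

/-- `b` is the `α`-numeration of the real number `β`: an `α`-admissible sequence with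
`β = ∑_{j ≥ 1} b_j (-1)^{j-1} δ_{j-1}`, where `(-1)^i δ_i = q_i α - p_i`. -/
def IsRealNumeration (α : ℝ) (b : ℕ → ℕ) (β : ℝ) : Prop :=
  IsAdmissible α b ∧
    HasSum (fun i => (b i : ℝ) * ((convDen α i : ℝ) * α - (convNum α i : ℝ))) β

/-- The strict reversed lexicographic order `<_R`. -/
def ltR (d d' : ℕ → ℕ) : Prop := ∃ j, d j < d' j ∧ ∀ i, j < i → d i = d' i

/-- The strict alternate lexicographic order `<_A`. -/
def ltA (d d' : ℕ → ℕ) : Prop :=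
  ∃ j, (-1 : ℤ) ^ j * (d j : ℤ) < (-1 : ℤ) ^ j * (d' j : ℤ) ∧ ∀ i, i < j → d i = d' i

/-- `ν₀ = ν`, and `ν_k = ⌊ν_{k-1} α_{k-1}⌋` if `n_{k+1} ≠ 0` or `σ^k (n)` is null,
`ν_k = ⌊ν_{k-1} α_{k-1}⌋ + 1` otherwise. -/
noncomputable def nuSeq (α : ℝ) (n : ℕ → ℕ) (ν : ℕ) : ℕ → ℤ
  | 0 => (ν : ℤ)
  | k + 1 =>
    open Classical in
    if n (k + 1) ≠ 0 ∨ IsNull (shift (k + 1) n) then ⌊(nuSeq α n ν k : ℝ) * gaussIter α k⌋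
    else ⌊(nuSeq α n ν k : ℝ) * gaussIter α k⌋ + 1

/-- `τ_{i+1}`: it is `1` if `n_{i+1} n_{i+2} = 0` and `σ^{i+1} (n)` is not null, and
`min (b_{i+1}, n_{i+1})` otherwise. -/
noncomputable def tau (b n : ℕ → ℕ) (i : ℕ) : ℤ :=
  open Classical in
  if n i * n (i + 1) = 0 ∧ ¬ IsNull (shift (i + 1) n) then 1 else ((min (b i) (n i) : ℕ) : ℤ)

/-- `ε_{i+1}`: it is `1` if `b_{i+1} < n_{i+1}` and `σ^{i+1} (b) <_A σ^{i+1} (n)`, and `0`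
otherwise. -/
noncomputable def eps (b n : ℕ → ℕ) (i : ℕ) : ℤ :=
  open Classical in
  if b i < n i ∧ ltA (shift (i + 1) b) (shift (i + 1) n) then 1 else 0

/-- `ε'_{i+1}`: it is `1` if `σ^{i+1} (b) <_R σ^{i+1} (n)`, and `0` otherwise. -/
noncomputable def eps' (b n : ℕ → ℕ) (i : ℕ) : ℤ :=
  open Classical in
  if ltR (shift (i + 1) b) (shift (i + 1) n) then 1 else 0

/-- `C(α, β, ν)`, the number of integers `k` with `0 ≤ k < ν` and `{k α} < β`. -/
noncomputable def count (α β : ℝ) (ν : ℕ) : ℕ :=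
  Set.ncard {k : ℕ | k < ν ∧ Int.fract ((k : ℝ) * α) < β}

end AlphaNumeration

namespace AlphaNumeration

/-! The proof is a recursion along the Gauss map. Let α' = {1/α}. A finite digit sequence d over α
has an integer value N and a real value η; primes denote the values of σ(d) over α'. Then Nα = N' +
η (`intVal_mul`) and η = α(d₁ - η') (`IsPreadmissible.realVal_eq`), with -α < η < 1 for α > 0. A
shift may create a leading zero and hence a negative value. The induction therefore runs over
`IsPreadmissible` sequences and over `signedCount`, which makes sense for negative β too; its upper
limit is N, raised by one when η < 0 ≤ β.

Group the integers k by rows m = ⌊kα⌋. For β ≥ 0, row m contains ⌈(m+β)/α⌉ - ⌈m/α⌉ counted integers.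
If α' ≠ 0, inserting 1/α = a₁ + α' and β = α(b₁ - β') turns this into b₁ + ⌈mα' - β'⌉ - ⌈mα'⌉. With
floors in place of ceilings, the sum over m < M is b₁M, minus the signed count for (α', β'), minus
the number of m with mα' - β' an integer, plus 1 for m = 0 if M > 0 (`rowSum_eq`).

At most one m gives such an integer, namely the integer value of σ(b), and it lies below the limit
exactly if σ(b) <_R σ(n): this is ε' (`sum_indicator_eq_ltR`). The incomplete last row produces τ
and ε; it involves the comparison β' < η', which is <_A (`ltA_iff`). `signedCount_add_signedCount`
collects one step, and `digit_sum_eq_signedCount` iterates it with alternating signs until one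
sequence is exhausted. -/

/-! ### The Gauss map, partial quotients and convergents -/

theorem shift_apply (k : ℕ) (d : ℕ → ℕ) (i : ℕ) : shift k d i = d (k + i) := rfl

theorem shift_one_shift (k : ℕ) (d : ℕ → ℕ) : shift k (shift 1 d) = shift (k + 1) d := by
  funext i
  simp only [shift_apply]
  congr 1
  omega

theorem gaussIter_succ_eq (α : ℝ) (k : ℕ) :
    gaussIter α (k + 1) = gaussIter (gaussIter α 1) k := by
  induction k with
  | zero => rfl
  | succ k ih =>
    rw [gaussIter, ih]
    rfl

theorem quot_succ_eq (α : ℝ) (i : ℕ) : quot α (i + 1) = quot (gaussIter α 1) i := by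
  simp only [quot, gaussIter_succ_eq α i]

/-- Together with `convDen_succ_eq` this is [0, a₁, a₂, …] = 1/(a₁ + [0, a₂, …]) for convergents. -/
theorem convNum_succ_eq (α : ℝ) :
    ∀ i, convNum α (i + 1) = convDen (gaussIter α 1) i
  | 0 => rfl
  | 1 => by simp [convNum, convDen, quot_succ_eq]
  | i + 2 => by
    rw [convNum, convDen, convNum_succ_eq α i, convNum_succ_eq α (i + 1), quot_succ_eq]

theorem convDen_succ_eq (α : ℝ) :
    ∀ i, convDen α (i + 1)
      = quot α 0 * convDen (gaussIter α 1) i + convNum (gaussIter α 1) i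
  | 0 => by simp [convDen, convNum]
  | 1 => by
    simp only [convDen, convNum, quot_succ_eq]
    ring
  | i + 2 => by
    rw [convDen, convDen_succ_eq α i, convDen_succ_eq α (i + 1), quot_succ_eq,
      convDen.eq_3 (gaussIter α 1) i, convNum.eq_3 (gaussIter α 1) i]
    ring

theorem gaussIter_one_nonneg (α : ℝ) : 0 ≤ gaussIter α 1 := Int.fract_nonneg _

theorem gaussIter_one_lt_one (α : ℝ) : gaussIter α 1 < 1 := Int.fract_lt_one _

/-- The second alternative reflects the expansion ending in 1: if 1/α is an integer, the partial
quotient is 1/α - 1 and the expansion stops. -/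
theorem gauss_step {α : ℝ} (h0 : 0 < α) (h1 : α < 1) :
    1 ≤ quot α 0 ∧
      ((0 < gaussIter α 1 ∧ α * (quot α 0 + gaussIter α 1) = 1) ∨
        (gaussIter α 1 = 0 ∧ α * (quot α 0 + 1) = 1)) := by
  have hinv : 1 < 1 / α := by rw [lt_div_iff₀ h0]; linarith
  have hq : quot α 0 = (⌈1 / α⌉ - 1).toNat := by simp [quot, gaussIter, h0.ne']
  have hc : 2 ≤ ⌈1 / α⌉ := by
    have : (1 : ℤ) < ⌈1 / α⌉ := by rw [Int.lt_ceil]; exact_mod_cast hinv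
    omega
  have hqz : (quot α 0 : ℤ) = ⌈1 / α⌉ - 1 := by rw [hq]; omega
  have hqr : (quot α 0 : ℝ) = (⌈1 / α⌉ : ℝ) - 1 := by exact_mod_cast hqz
  have hg : gaussIter α 1 = Int.fract (1 / α) := rfl
  refine ⟨by omega, ?_⟩
  rcases eq_or_ne (Int.fract (1 / α)) 0 with h | h
  · right
    refine ⟨hg.trans h, ?_⟩
    have h2 : (⌈1 / α⌉ : ℝ) = 1 / α := by
      obtain ⟨z, hz⟩ := Int.fract_eq_zero_iff.1 h
      rw [← hz, Int.ceil_intCast]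
    rw [hqr, h2]
    field_simp
    ring
  · left
    refine ⟨lt_of_le_of_ne (Int.fract_nonneg _) (Ne.symm h), ?_⟩
    have h2 : (⌈1 / α⌉ : ℝ) = 1 / α + 1 - Int.fract (1 / α) := Int.ceil_eq_add_one_sub_fract h
    rw [hqr, h2, hg]
    field_simp
    ring

theorem quot_zero (i : ℕ) : quot 0 i = 0 := by
  have : gaussIter 0 i = 0 := by
    induction i with
    | zero => rfl
    | succ i ih => simp [gaussIter, ih]
  simp [quot, this]

/-! ### Shifted digit sequences and their values -/

/-- The sequences obtained from `α`-admissible sequences by shifts: the condition on zeros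
is dropped for the first digit. -/
structure IsPreadmissible (α : ℝ) (d : ℕ → ℕ) : Prop where
  le_quot : ∀ i, d i ≤ quot α i
  eq_zero : ∀ i, d (i + 1) = 0 → (∀ j, i + 1 ≤ j → d j = 0) ∨ d i = quot α i
  not_tail : ¬ ∃ m, ∀ t, 0 < quot α (m + 2 * t) ∧ d (m + 2 * t) = quot α (m + 2 * t) ∧
    d (m + 2 * t + 1) = 0
  summable : Summable fun i => (d i : ℝ) * ((convDen α i : ℝ) * α - (convNum α i : ℝ))

/-- The real number represented by a digit sequence. -/
noncomputable def realVal (α : ℝ) (d : ℕ → ℕ) : ℝ :=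
  ∑' i, (d i : ℝ) * ((convDen α i : ℝ) * α - (convNum α i : ℝ))

/-- The integer represented by an eventually vanishing digit sequence. -/
noncomputable def intVal (α : ℝ) (d : ℕ → ℕ) : ℕ := ∑ᶠ i, d i * convDen α i

theorem intVal_eq_sum (α : ℝ) {d : ℕ → ℕ} {L : ℕ} (h : ∀ i, L ≤ i → d i = 0) :
    intVal α d = ∑ i ∈ Finset.range L, d i * convDen α i := by
  refine finsum_eq_sum_of_support_subset _ fun i hi => ?_
  by_contra hc
  simp only [Finset.coe_range, Set.mem_Iio, not_lt] at hc
  exact hi (by simp [h i hc])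

theorem shift_one_eq_zero_of_le {d : ℕ → ℕ} {L : ℕ} (h : ∀ i, L ≤ i → d i = 0) :
    ∀ i, L ≤ i → shift 1 d i = 0 := fun i hi => h _ (by omega)

theorem intVal_rec (α : ℝ) {d : ℕ → ℕ} {L : ℕ} (h : ∀ i, L ≤ i → d i = 0) :
    intVal α d = d 0 + quot α 0 * intVal (gaussIter α 1) (shift 1 d)
      + intVal (gaussIter (gaussIter α 1) 1) (shift 1 (shift 1 d)) := by
  have h1 := shift_one_eq_zero_of_le h
  rw [intVal_eq_sum α (L := L + 2) fun i hi => h i (by omega),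
    intVal_eq_sum _ (L := L + 1) fun i hi => h1 i (by omega),
    intVal_eq_sum _ (shift_one_eq_zero_of_le h1)]
  rw [Finset.sum_range_succ' _ (L + 1)]
  have : ∀ i, d (i + 1) * convDen α (i + 1)
      = quot α 0 * (shift 1 d i * convDen (gaussIter α 1) i)
        + shift 1 d i * convNum (gaussIter α 1) i := by
    intro i
    rw [convDen_succ_eq, shift_apply, add_comm 1 i]
    ring
  simp only [this]
  rw [Finset.sum_add_distrib, ← Finset.mul_sum,
    Finset.sum_range_succ' (fun i => shift 1 d i * convNum (gaussIter α 1) i)]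
  have h2 : ∀ i, shift 1 d (i + 1) * convNum (gaussIter α 1) (i + 1)
      = shift 1 (shift 1 d) i * convDen (gaussIter (gaussIter α 1) 1) i := by
    intro i
    rw [convNum_succ_eq, shift_apply 1 (shift 1 d), add_comm 1 i]
  simp only [h2]
  simp [convNum, convDen]
  ring

theorem realVal_of_null {α : ℝ} {d : ℕ → ℕ} (h : IsNull d) : realVal α d = 0 := by
  have h' : ∀ i, d i = 0 := h
  simp [realVal, h']

theorem intVal_of_null {α : ℝ} {d : ℕ → ℕ} (h : IsNull d) : intVal α d = 0 := by
  have h' : ∀ i, d i = 0 := h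
  simp [intVal, h']

theorem summable_of_eq_zero (α : ℝ) {d : ℕ → ℕ} {L : ℕ} (h : ∀ i, L ≤ i → d i = 0) :
    Summable fun i => (d i : ℝ) * ((convDen α i : ℝ) * α - (convNum α i : ℝ)) := by
  refine summable_of_ne_finset_zero (s := Finset.range L) fun i hi => ?_
  simp [h i (by simpa using hi)]

/-- Split q_i α = p_i + (q_i α - p_i); the numerators p_{i+1} of α are the denominators q_i of its
Gauss image. -/
theorem intVal_mul (α : ℝ) {d : ℕ → ℕ} {L : ℕ} (h : ∀ i, L ≤ i → d i = 0) :
    (intVal α d : ℝ) * α = intVal (gaussIter α 1) (shift 1 d) + realVal α d := by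
  have h1 := shift_one_eq_zero_of_le h
  rw [intVal_eq_sum α (L := L + 1) fun i hi => h i (by omega),
    intVal_eq_sum _ h1, realVal, tsum_eq_sum (s := Finset.range (L + 1)) fun i hi => by
      simp [h i (by simp at hi; omega)]]
  have : ∑ i ∈ Finset.range L, shift 1 d i * convDen (gaussIter α 1) i
      = ∑ i ∈ Finset.range (L + 1), d i * convNum α i := by
    rw [Finset.sum_range_succ']
    simp [convNum_succ_eq, convNum.eq_1, shift_apply, add_comm 1]
  rw [this]
  push_cast
  rw [Finset.sum_mul, ← Finset.sum_add_distrib]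
  exact Finset.sum_congr rfl fun i _ => by ring

theorem IsPreadmissible.null_of_zero {d : ℕ → ℕ} (h : IsPreadmissible 0 d) : IsNull d :=
  fun i => by simpa [quot_zero] using h.le_quot i

theorem quot_eq_zero_of_gaussIter_one {α : ℝ} (h : gaussIter α 1 = 0) (i : ℕ) :
    quot α (i + 1) = 0 := by
  rw [quot_succ_eq, h, quot_zero]

theorem term_succ {α : ℝ} {d : ℕ → ℕ} (h0 : 0 < α) (h1 : α < 1)
    (hd : ∀ i, d i ≤ quot α i) (i : ℕ) :
    (d (i + 1) : ℝ) * ((convDen α (i + 1) : ℝ) * α - (convNum α (i + 1) : ℝ))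
      = -α * ((shift 1 d i : ℝ) * ((convDen (gaussIter α 1) i : ℝ) * gaussIter α 1
        - (convNum (gaussIter α 1) i : ℝ))) := by
  rw [shift_apply, add_comm 1 i]
  rcases (gauss_step h0 h1).2 with ⟨_, h⟩ | ⟨h, _⟩
  · rw [convNum_succ_eq, convDen_succ_eq]
    push_cast
    linear_combination (d (i + 1) : ℝ) * (convDen (gaussIter α 1) i) * h
  -- When the Gauss image is 0, the identity between the coefficients fails, but the digit is 0.
  · have := hd (i + 1)
    rw [quot_eq_zero_of_gaussIter_one h] at this
    simp [Nat.le_zero.1 this]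

theorem IsPreadmissible.shift_one {α : ℝ} {d : ℕ → ℕ} (h0 : 0 < α) (h1 : α < 1)
    (h : IsPreadmissible α d) : IsPreadmissible (gaussIter α 1) (shift 1 d) where
  le_quot i := by rw [← quot_succ_eq, shift_apply, add_comm 1]; exact h.le_quot _
  eq_zero i hi := by
    rw [shift_apply] at hi
    rcases h.eq_zero (1 + i) hi with h' | h'
    · exact .inl fun j hj => h' _ (by omega)
    · right
      rw [← quot_succ_eq, shift_apply, h', add_comm]
  not_tail := by
    rintro ⟨m, hm⟩
    refine h.not_tail ⟨m + 1, fun t => ?_⟩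
    have := hm t
    rw [← quot_succ_eq, shift_apply, shift_apply] at this
    rw [show m + 1 + 2 * t = m + 2 * t + 1 by ring]
    rw [show 1 + (m + 2 * t) = m + 2 * t + 1 by ring,
      show 1 + (m + 2 * t + 1) = m + 2 * t + 1 + 1 by ring] at this
    exact this
  summable := by
    have := (summable_nat_add_iff 1).2 h.summable
    simp only [term_succ h0 h1 h.le_quot] at this
    exact (summable_mul_left_iff (neg_ne_zero.2 h0.ne')).1 this

theorem IsPreadmissible.realVal_eq {α : ℝ} {d : ℕ → ℕ} (h0 : 0 < α) (h1 : α < 1)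
    (h : IsPreadmissible α d) :
    realVal α d = α * (d 0 - realVal (gaussIter α 1) (shift 1 d)) := by
  rw [realVal, h.summable.tsum_eq_zero_add]
  simp only [term_succ h0 h1 h.le_quot]
  rw [tsum_mul_left]
  simp [convDen, convNum, realVal]
  ring

/-! ### Range and sign of the real values -/

/-- A partial sum is α(d₁ - S) with S a shorter sum over α', so each bound for it follows from the
opposite bound for S, using α(a₁ + α') ≤ 1. -/
theorem sum_range_mem_Icc (L : ℕ) : ∀ {α : ℝ} {d : ℕ → ℕ}, 0 ≤ α → α < 1 →
    (∀ i, d i ≤ quot α i) →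
    ∑ i ∈ Finset.range L, (d i : ℝ) * ((convDen α i : ℝ) * α - (convNum α i : ℝ))
      ∈ Set.Icc (-α) 1 := by
  induction L with
  | zero =>
    intro α d h0 _ _
    simp [h0]
  | succ L ih =>
    intro α d h0 h1 hd
    rcases h0.eq_or_lt with rfl | h0
    · have : ∀ i, d i = 0 := fun i => by simpa [quot_zero] using hd i
      simp [this]
    rw [Finset.sum_range_succ']
    simp only [term_succ h0 h1 hd]
    rw [← Finset.mul_sum]
    have hd' : ∀ i, shift 1 d i ≤ quot (gaussIter α 1) i := fun i => by
      rw [← quot_succ_eq, shift_apply, add_comm 1]; exact hd _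
    have := ih (gaussIter_one_nonneg α) (gaussIter_one_lt_one α) hd'
    obtain ⟨hl, hu⟩ := this
    have ha : (d 0 : ℝ) ≤ quot α 0 := by exact_mod_cast hd 0
    have hd0 : (0 : ℝ) ≤ d 0 := Nat.cast_nonneg _
    set S := ∑ i ∈ Finset.range L, (shift 1 d i : ℝ) *
      ((convDen (gaussIter α 1) i : ℝ) * gaussIter α 1 - (convNum (gaussIter α 1) i : ℝ))
    have hq : α * (quot α 0 + gaussIter α 1) ≤ 1 := by
      rcases (gauss_step h0 h1).2 with ⟨_, h⟩ | ⟨h, h'⟩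
      · exact h.le
      · rw [h]; nlinarith
    simp only [convDen, convNum, Nat.cast_one, Nat.cast_zero, Set.mem_Icc]
    constructor
    · nlinarith
    · nlinarith

theorem IsPreadmissible.realVal_mem_Icc {α : ℝ} {d : ℕ → ℕ} (h0 : 0 ≤ α) (h1 : α < 1)
    (h : IsPreadmissible α d) : realVal α d ∈ Set.Icc (-α) 1 :=
  isClosed_Icc.mem_of_tendsto h.summable.hasSum.tendsto_sum_nat
    (.of_forall fun L => sum_range_mem_Icc L h0 h1 h.le_quot)

theorem IsPreadmissible.null_shift {α : ℝ} {d : ℕ → ℕ} (h0 : 0 < α) (h1 : α < 1)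
    (h : IsPreadmissible α d) (hg : gaussIter α 1 = 0) : IsNull (shift 1 d) := by
  have := h.shift_one h0 h1
  rw [hg] at this
  exact this.null_of_zero

/-- Equality forces both estimates of two consecutive steps to be sharp. Iterated, this gives the
digits a, 0, a, 0, … that `not_tail` forbids, so the value 1 is never attained. -/
theorem IsPreadmissible.of_realVal_eq_one {α : ℝ} {d : ℕ → ℕ} (h0 : 0 ≤ α) (h1 : α < 1)
    (h : IsPreadmissible α d) (hv : realVal α d = 1) :
    0 < α ∧ 0 < gaussIter α 1 ∧ 0 < quot α 0 ∧ d 0 = quot α 0 ∧ d 1 = 0 ∧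
      realVal (gaussIter (gaussIter α 1) 1) (shift 1 (shift 1 d)) = 1 := by
  rcases h0.eq_or_lt with rfl | h0
  · rw [realVal_of_null h.null_of_zero] at hv
    norm_num at hv
  obtain ⟨ha, hs⟩ := gauss_step h0 h1
  rw [h.realVal_eq h0 h1] at hv
  have hd0 : (d 0 : ℝ) ≤ quot α 0 := by exact_mod_cast h.le_quot 0
  rcases hs with ⟨hg, hs⟩ | ⟨hg, hs⟩
  · have h' := h.shift_one h0 h1
    have hb := (h'.realVal_mem_Icc hg.le (gaussIter_one_lt_one α)).1
    have e : (d 0 : ℝ) - realVal (gaussIter α 1) (shift 1 d)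
        = quot α 0 + gaussIter α 1 := mul_left_cancel₀ h0.ne' (hv.trans hs.symm)
    have e0 : (d 0 : ℝ) = quot α 0 := by linarith
    have e1 : realVal (gaussIter α 1) (shift 1 d) = -gaussIter α 1 := by linarith
    rw [h'.realVal_eq hg (gaussIter_one_lt_one α)] at e1
    have h'' := h'.shift_one hg (gaussIter_one_lt_one α)
    have hb2 := (h''.realVal_mem_Icc (gaussIter_one_nonneg _) (gaussIter_one_lt_one _)).2
    have e2 : (shift 1 d 0 : ℝ)
        - realVal (gaussIter (gaussIter α 1) 1) (shift 1 (shift 1 d)) = -1 :=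
      mul_left_cancel₀ hg.ne' (by linarith)
    have hd1 : (0 : ℝ) ≤ shift 1 d 0 := Nat.cast_nonneg _
    have hd1' : (shift 1 d 0 : ℝ) = 0 := by linarith
    exact ⟨h0, hg, ha, by exact_mod_cast e0, by exact_mod_cast hd1', by linarith⟩
  · exfalso
    rw [realVal_of_null (h.null_shift h0 h1 hg)] at hv
    nlinarith

theorem IsPreadmissible.digits_of_realVal_eq_one (t : ℕ) : ∀ {α : ℝ} {d : ℕ → ℕ}, 0 ≤ α → α < 1 →
    IsPreadmissible α d → realVal α d = 1 →
    0 < quot α (2 * t) ∧ d (2 * t) = quot α (2 * t) ∧ d (2 * t + 1) = 0 := by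
  induction t with
  | zero =>
    intro α d h0 h1 h hv
    obtain ⟨_, _, h2, h3, h4, _⟩ := h.of_realVal_eq_one h0 h1 hv
    exact ⟨h2, h3, h4⟩
  | succ t ih =>
    intro α d h0 h1 h hv
    obtain ⟨hα, hg, _, _, _, hv'⟩ := h.of_realVal_eq_one h0 h1 hv
    have := ih (gaussIter_one_nonneg _) (gaussIter_one_lt_one _)
      ((h.shift_one hα h1).shift_one hg (gaussIter_one_lt_one _)) hv'
    rw [← quot_succ_eq, ← quot_succ_eq, shift_apply, shift_apply, shift_apply, shift_apply] at this
    rw [show 2 * (t + 1) = 2 * t + 1 + 1 by ring]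
    rw [show 1 + (1 + 2 * t) = 2 * t + 1 + 1 by ring,
      show 1 + (1 + (2 * t + 1)) = 2 * t + 1 + 1 + 1 by ring] at this
    exact this

theorem IsPreadmissible.realVal_lt_one {α : ℝ} {d : ℕ → ℕ} (h0 : 0 ≤ α) (h1 : α < 1)
    (h : IsPreadmissible α d) : realVal α d < 1 := by
  refine lt_of_le_of_ne (h.realVal_mem_Icc h0 h1).2 fun hv => h.not_tail ⟨0, fun t => ?_⟩
  rw [zero_add]
  exact h.digits_of_realVal_eq_one t h0 h1 hv

theorem IsPreadmissible.neg_lt_realVal {α : ℝ} {d : ℕ → ℕ} (h0 : 0 < α) (h1 : α < 1)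
    (h : IsPreadmissible α d) : -α < realVal α d := by
  rw [h.realVal_eq h0 h1]
  have := (h.shift_one h0 h1).realVal_lt_one (gaussIter_one_nonneg _) (gaussIter_one_lt_one _)
  have hd : (0 : ℝ) ≤ d 0 := Nat.cast_nonneg _
  nlinarith

theorem IsPreadmissible.realVal_pos {α : ℝ} {d : ℕ → ℕ} (h0 : 0 < α) (h1 : α < 1)
    (h : IsPreadmissible α d) (hd : d 0 ≠ 0) : 0 < realVal α d := by
  rw [h.realVal_eq h0 h1]
  have := (h.shift_one h0 h1).realVal_lt_one (gaussIter_one_nonneg _) (gaussIter_one_lt_one _)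
  have hd : (1 : ℝ) ≤ d 0 := by exact_mod_cast Nat.one_le_iff_ne_zero.2 hd
  exact mul_pos h0 (by linarith)

theorem IsPreadmissible.shift_ne_zero {α : ℝ} {d : ℕ → ℕ} (h0 : 0 < α) (h1 : α < 1)
    (h : IsPreadmissible α d) (hd : d 0 = 0) (hn : ¬ IsNull d) : shift 1 d 0 ≠ 0 := by
  intro h2
  rcases h.eq_zero 0 h2 with h3 | h3
  · refine hn fun i => ?_
    rcases i with _ | i
    · exact hd
    · exact h3 _ (by omega)
  · have := (gauss_step h0 h1).1
    omega

theorem IsPreadmissible.realVal_shift_pos {α : ℝ} {d : ℕ → ℕ} (h0 : 0 < α) (h1 : α < 1)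
    (h : IsPreadmissible α d) (hd : d 0 = 0) (hn : ¬ IsNull d) :
    0 < realVal (gaussIter α 1) (shift 1 d) := by
  have hs := h.shift_ne_zero h0 h1 hd hn
  rcases (gaussIter_one_nonneg α).eq_or_lt with hg | hg
  · exact absurd (h.null_shift h0 h1 hg.symm 0) hs
  · exact (h.shift_one h0 h1).realVal_pos hg (gaussIter_one_lt_one _) hs

theorem IsPreadmissible.realVal_neg {α : ℝ} {d : ℕ → ℕ} (h0 : 0 < α) (h1 : α < 1)
    (h : IsPreadmissible α d) (hd : d 0 = 0) (hn : ¬ IsNull d) : realVal α d < 0 := by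
  rw [h.realVal_eq h0 h1, hd]
  have := h.realVal_shift_pos h0 h1 hd hn
  push_cast
  nlinarith

theorem IsPreadmissible.realVal_neg_iff {α : ℝ} {d : ℕ → ℕ} (h0 : 0 ≤ α) (h1 : α < 1)
    (h : IsPreadmissible α d) : realVal α d < 0 ↔ d 0 = 0 ∧ ¬ IsNull d := by
  rcases h0.eq_or_lt with rfl | h0
  · simp [realVal_of_null h.null_of_zero, h.null_of_zero]
  refine ⟨fun hv => ⟨?_, ?_⟩, fun hd => h.realVal_neg h0 h1 hd.1 hd.2⟩
  · by_contra hd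
    exact (h.realVal_pos h0 h1 hd).not_gt hv
  · intro hn
    rw [realVal_of_null hn] at hv
    exact hv.false

theorem IsPreadmissible.realVal_eq_zero_iff {α : ℝ} {d : ℕ → ℕ} (h0 : 0 ≤ α) (h1 : α < 1)
    (h : IsPreadmissible α d) : realVal α d = 0 ↔ IsNull d := by
  refine ⟨fun hv => ?_, realVal_of_null⟩
  rcases h0.eq_or_lt with rfl | h0
  · exact h.null_of_zero
  by_contra hn
  by_cases hd : d 0 = 0
  · exact (h.realVal_neg h0 h1 hd hn).ne hv
  · exact (h.realVal_pos h0 h1 hd).ne' hv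

theorem IsPreadmissible.eq_quot_of_shift_neg {α : ℝ} {d : ℕ → ℕ} (h0 : 0 < α) (h1 : α < 1)
    (h : IsPreadmissible α d) (hv : realVal (gaussIter α 1) (shift 1 d) < 0) :
    d 0 = quot α 0 := by
  obtain ⟨hz, hn⟩ := ((h.shift_one h0 h1).realVal_neg_iff (gaussIter_one_nonneg _)
    (gaussIter_one_lt_one _)).1 hv
  rcases h.eq_zero 0 hz with h3 | h3
  · exact absurd (fun i => h3 _ (by omega)) hn
  · exact h3

/-! ### Integer values: bounds and uniqueness -/

/-- For rational `α` the integers with an `α`-numeration are smaller than its denominator. -/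
theorem IsPreadmissible.intVal_lt (L : ℕ) : ∀ {α : ℝ} {d : ℕ → ℕ}, 0 ≤ α → α < 1 →
    IsPreadmissible α d → (∀ i, L ≤ i → d i = 0) → ∀ {k : ℕ} {l : ℤ}, 0 < k → k * α = l →
    intVal α d < k := by
  induction L with
  | zero =>
    intro α d _ _ _ hz k l hk _
    rwa [intVal_of_null fun i => hz i (Nat.zero_le _)]
  | succ L ih =>
    intro α d h0 h1 h hz k l hk hl
    rcases h0.eq_or_lt with rfl | h0
    · rwa [intVal_of_null h.null_of_zero]
    have hk' : (0 : ℝ) < k := by exact_mod_cast hk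
    have hl0 : 0 < l := by
      have : (0 : ℝ) < l := by rw [← hl]; positivity
      exact_mod_cast this
    lift l to ℕ using hl0.le
    have hN : intVal (gaussIter α 1) (shift 1 d) < l := by
      rcases (gauss_step h0 h1).2 with ⟨hg, hs⟩ | ⟨hg, hs⟩
      · refine ih hg.le (gaussIter_one_lt_one _) (h.shift_one h0 h1)
          (fun i hi => hz _ (by omega)) (l := k - l * quot α 0) (by exact_mod_cast hl0) ?_
        push_cast at hl ⊢
        rw [← hl]
        linear_combination (k : ℝ) * hs
      · rw [intVal_of_null (h.null_shift h0 h1 hg)]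
        exact_mod_cast hl0
    have hN' : (intVal (gaussIter α 1) (shift 1 d) : ℝ) + 1 ≤ l := by exact_mod_cast hN
    have e := intVal_mul α hz
    have hv := h.realVal_lt_one h0.le h1
    have : (intVal α d : ℝ) * α < k * α := by
      rw [hl]; push_cast; linarith
    exact_mod_cast lt_of_mul_lt_mul_right this h0.le

/-- Descent: if mα - η = l is an integer, then l plays the role of m for α' and the shifted
sequence. The last hypothesis is void for irrational α and says that m is below the denominator for
rational α. -/
theorem IsPreadmissible.exists_intVal_eq (w : ℕ) : ∀ {α : ℝ} {d : ℕ → ℕ} {m : ℕ} {l : ℤ},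
    0 ≤ α → α < 1 → IsPreadmissible α d →
    2 * m + (if realVal α d < 0 then 1 else 0) ≤ w → m * α - realVal α d = l →
    (∀ (k : ℕ) (j : ℤ), 0 < k → k * α = j → m < k) →
    (∃ L, ∀ i, L ≤ i → d i = 0) ∧ intVal α d = m := by
  induction w using Nat.strong_induction_on with
  | _ w ih =>
  intro α d m l h0 h1 h hw hl hm
  by_cases hn : IsNull d
  · refine ⟨⟨0, fun i _ => hn i⟩, ?_⟩
    rw [intVal_of_null hn]
    by_contra hc
    have := hm m l (by omega) (by rw [realVal_of_null hn] at hl; linarith)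
    omega
  rcases h0.eq_or_lt with rfl | h0
  · exact absurd h.null_of_zero hn
  have hv := h.realVal_eq h0 h1
  have hv1 := h.realVal_lt_one h0.le h1
  have hv2 := h.neg_lt_realVal h0 h1
  have hm0 : (0 : ℝ) ≤ m := Nat.cast_nonneg _
  obtain ⟨ha, hs⟩ := gauss_step h0 h1
  rcases hs with ⟨hg, hs⟩ | ⟨hg, hs⟩
  · have hl0 : 0 ≤ l := by
      have : (-1 : ℝ) < l := by rw [← hl]; nlinarith
      have : (-1 : ℤ) < l := by exact_mod_cast this
      omega
    lift l to ℕ using hl0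
    push_cast at hl
    -- For η < 0 only l ≤ m is available, but then η' > 0 and the indicator drops; for η > 0 already
    -- l < m. The weight 2 makes both cases a strict decrease.
    have hlm : 2 * l + (if realVal (gaussIter α 1) (shift 1 d) < 0 then 1 else 0) < w := by
      rcases lt_trichotomy (realVal α d) 0 with h2 | h2 | h2
      · have hz := (h.realVal_neg_iff h0.le h1).1 h2
        have := h.realVal_shift_pos h0 h1 hz.1 hz.2
        rw [if_neg this.not_gt]
        rw [if_pos h2] at hw
        have : (l : ℝ) < m + 1 := by nlinarith
        have : l < m + 1 := by exact_mod_cast this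
        omega
      · exact absurd ((h.realVal_eq_zero_iff h0.le h1).1 h2) hn
      · rw [if_neg h2.not_gt] at hw
        have : (l : ℝ) < m := by nlinarith
        have : l < m := by exact_mod_cast this
        split_ifs <;> omega
    have e1 : (l : ℝ) * gaussIter α 1 - realVal (gaussIter α 1) (shift 1 d)
        = m - d 0 - l * quot α 0 := by
      have : α * (l * (quot α 0 + gaussIter α 1) - realVal (gaussIter α 1) (shift 1 d)
          - m + d 0) = 0 := by
        rw [← hl]
        linear_combination (m * α - realVal α d) * hs - hv
      have := (mul_eq_zero.1 this).resolve_left h0.ne'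
      linarith
    obtain ⟨⟨L, hL⟩, hN⟩ := ih _ hlm hg.le (gaussIter_one_lt_one _) (h.shift_one h0 h1) le_rfl
      -- If kα' = j, then (k a₁ + j)α = k, so m < k a₁ + j; since l < (m + 1)α, this gives l < k.
      (l := m - d 0 - l * quot α 0) (by push_cast; exact e1) (by
        intro k j hk hj
        have hk' : (1 : ℝ) ≤ k := by exact_mod_cast hk
        have hj0 : 0 ≤ j := by
          have : (0 : ℝ) ≤ j := by rw [← hj]; positivity
          exact_mod_cast this
        have e : ((k * quot α 0 + j.toNat : ℕ) : ℝ) * α = k := by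
          have : ((j.toNat : ℕ) : ℝ) = j := by exact_mod_cast Int.toNat_of_nonneg hj0
          push_cast
          rw [this, ← hj]
          linear_combination (k : ℝ) * hs
        have := hm (k * quot α 0 + j.toNat) k (by positivity) (by exact_mod_cast e)
        have : ((m + 1 : ℕ) : ℝ) ≤ ((k * quot α 0 + j.toNat : ℕ) : ℝ) := by exact_mod_cast this
        have : (l : ℝ) < k := by
          rw [← e, ← hl]
          push_cast at this ⊢
          nlinarith
        exact_mod_cast this)
    have hz : ∀ i, L + 1 ≤ i → d i = 0 := fun i hi => by
      have := hL (i - 1) (by omega)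
      rwa [shift_apply, show 1 + (i - 1) = i by omega] at this
    refine ⟨⟨L + 1, hz⟩, ?_⟩
    have e2 := intVal_mul (gaussIter α 1) hL
    rw [hN] at e2
    have e3 := intVal_rec α hz
    rw [hN] at e3
    have : (intVal α d : ℝ) = m := by
      rw [e3]
      push_cast
      linarith
    exact_mod_cast this
  · have hnull := h.null_shift h0 h1 hg
    have hz : ∀ i, 1 ≤ i → d i = 0 := fun i hi => by
      have := hnull (i - 1)
      rwa [shift_apply, show 1 + (i - 1) = i by omega] at this
    refine ⟨⟨1, hz⟩, ?_⟩
    have hd := h.le_quot 0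
    have hma := hm (quot α 0 + 1) 1 (by omega) (by push_cast; linarith)
    rw [realVal_of_null hnull] at hv
    rw [intVal_rec α hz, intVal_of_null hnull, intVal_of_null (d := shift 1 (shift 1 d)) (fun i => hnull (1 + i))]
    have e : ((m : ℤ) - d 0 : ℤ) = l * (quot α 0 + 1) := by
      have : ((m : ℝ) - d 0) = l * (quot α 0 + 1) := by
        rw [← hl, hv]
        linear_combination (-(m : ℝ) + d 0) * hs
      exact_mod_cast this
    -- Both m and the first digit lie in {0, …, a₁}, so their difference is a multiple of a₁ + 1
    -- only if it is 0.
    have hl0 : l = 0 := by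
      have h2 : l < 1 := by by_contra hc; push Not at hc; nlinarith
      have h3 : -1 < l := by by_contra hc; push Not at hc; nlinarith
      omega
    rw [hl0] at e
    omega

/-! ### The two lexicographic orders -/

theorem IsPreadmissible.realVal_lt_of_head {α : ℝ} {b n : ℕ → ℕ} (h0 : 0 < α) (h1 : α < 1)
    (hb : IsPreadmissible α b) (hn : IsPreadmissible α n) (h : b 0 < n 0) :
    realVal α b < realVal α n := by
  rw [hb.realVal_eq h0 h1, hn.realVal_eq h0 h1]
  have hn1 := (hn.shift_one h0 h1).realVal_lt_one (gaussIter_one_nonneg _) (gaussIter_one_lt_one _)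
  have hb1 : 0 ≤ realVal (gaussIter α 1) (shift 1 b) := by
    by_contra hc
    have := hb.eq_quot_of_shift_neg h0 h1 (not_le.1 hc)
    have := hn.le_quot 0
    omega
  have : (b 0 : ℝ) + 1 ≤ n 0 := by exact_mod_cast h
  exact mul_lt_mul_of_pos_left (by linarith) h0

theorem ltA_trichotomy (b n : ℕ → ℕ) : b = n ∨ ltA b n ∨ ltA n b := by
  by_cases h : b = n
  · exact .inl h
  right
  have h' : ∃ j, b j ≠ n j := Function.ne_iff.1 h
  classical
  have hj := Nat.find_spec h'
  have hlt : ∀ i, i < Nat.find h' → b i = n i := fun i hi => not_not.1 (Nat.find_min h' hi)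
  have hz : (-1 : ℤ) ^ Nat.find h' * (b (Nat.find h') : ℤ)
      ≠ (-1 : ℤ) ^ Nat.find h' * (n (Nat.find h') : ℤ) := by
    intro he
    exact hj (by exact_mod_cast mul_left_cancel₀ (pow_ne_zero _ (by norm_num)) he)
  rcases lt_or_gt_of_ne hz with h1 | h1
  · exact .inl ⟨_, h1, hlt⟩
  · exact .inr ⟨_, h1, fun i hi => (hlt i hi).symm⟩

/-- In η = α(d₁ - η') the shifted value enters with a minus sign: each equal leading digit reverses
the comparison, as does the sign in <_A. -/
theorem realVal_lt_of_ltA (j : ℕ) : ∀ {α : ℝ} {b n : ℕ → ℕ}, 0 ≤ α → α < 1 →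
    IsPreadmissible α b → IsPreadmissible α n →
    (-1 : ℤ) ^ j * (b j : ℤ) < (-1 : ℤ) ^ j * (n j : ℤ) → (∀ i, i < j → b i = n i) →
    realVal α b < realVal α n := by
  induction j with
  | zero =>
    intro α b n h0 h1 hb hn h _
    rcases h0.eq_or_lt with rfl | h0
    · have e1 : b 0 = 0 := hb.null_of_zero 0
      have e2 : n 0 = 0 := hn.null_of_zero 0
      simp [e1, e2] at h
    · exact hb.realVal_lt_of_head h0 h1 hn (by simpa using h)
  | succ j ih =>
    intro α b n h0 h1 hb hn h he
    rcases h0.eq_or_lt with rfl | h0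
    · have e1 : b (j + 1) = 0 := hb.null_of_zero _
      have e2 : n (j + 1) = 0 := hn.null_of_zero _
      simp [e1, e2] at h
    · rw [hb.realVal_eq h0 h1, hn.realVal_eq h0 h1, he 0 (by omega)]
      have := ih (gaussIter_one_nonneg α) (gaussIter_one_lt_one α) (hn.shift_one h0 h1)
        (hb.shift_one h0 h1) (by
          rw [shift_apply, shift_apply, add_comm 1 j]
          rw [pow_succ] at h
          linarith) (fun i hi => (he _ (by omega)).symm)
      exact mul_lt_mul_of_pos_left (by linarith) h0

theorem ltA_iff {α : ℝ} {b n : ℕ → ℕ} (h0 : 0 ≤ α) (h1 : α < 1)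
    (hb : IsPreadmissible α b) (hn : IsPreadmissible α n) :
    ltA b n ↔ realVal α b < realVal α n := by
  refine ⟨fun ⟨j, hj, he⟩ => realVal_lt_of_ltA j h0 h1 hb hn hj he, fun h => ?_⟩
  rcases ltA_trichotomy b n with rfl | h' | ⟨j, hj, he⟩
  · exact absurd h (lt_irrefl _)
  · exact h'
  · exact absurd h (realVal_lt_of_ltA j h0 h1 hn hb hj he).not_gt

theorem ltR_trichotomy (L : ℕ) {b n : ℕ → ℕ} (hb : ∀ i, L ≤ i → b i = 0)
    (hn : ∀ i, L ≤ i → n i = 0) : b = n ∨ ltR b n ∨ ltR n b := by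
  induction L generalizing b n with
  | zero => exact .inl (funext fun i => by rw [hb i i.zero_le, hn i i.zero_le])
  | succ L ih =>
    have key : ∀ i, 0 < i → shift 1 b (i - 1) = b i ∧ shift 1 n (i - 1) = n i := fun i hi => by
      rw [shift_apply, shift_apply, show 1 + (i - 1) = i by omega]
      exact ⟨rfl, rfl⟩
    have lift : ∀ {c d : ℕ → ℕ}, ltR (shift 1 c) (shift 1 d) → ltR c d := by
      rintro c d ⟨j, hj, he⟩
      refine ⟨1 + j, hj, fun i hi => ?_⟩
      have := he (i - 1) (by omega)
      rwa [shift_apply, shift_apply, show 1 + (i - 1) = i by omega] at this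
    rcases ih (b := shift 1 b) (n := shift 1 n) (fun i hi => hb _ (by omega))
      (fun i hi => hn _ (by omega)) with h | h | h
    · have he : ∀ i, 0 < i → b i = n i := fun i hi => by
        rw [← (key i hi).1, ← (key i hi).2, h]
      rcases lt_trichotomy (b 0) (n 0) with h0 | h0 | h0
      · exact .inr (.inl ⟨0, h0, he⟩)
      · refine .inl (funext fun i => ?_)
        rcases i.eq_zero_or_pos with rfl | hi
        · exact h0
        · exact he i hi
      · exact .inr (.inr ⟨0, h0, fun i hi => (he i hi).symm⟩)
    · exact .inr (.inl (lift h))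
    · exact .inr (.inr (lift h))

/-- Compare Nα = N' + η for the two sequences, starting with N'. The extra 1 is needed since a
negative value of n can cost one unit. -/
theorem intVal_lt_of_ltR (j : ℕ) : ∀ {α : ℝ} {b n : ℕ → ℕ} {L : ℕ}, 0 ≤ α → α < 1 →
    IsPreadmissible α b → IsPreadmissible α n →
    (∀ i, L ≤ i → b i = 0) → (∀ i, L ≤ i → n i = 0) →
    b j < n j → (∀ i, j < i → b i = n i) →
    intVal α b < intVal α n + if realVal α n < 0 ∧ 0 ≤ realVal α b then 1 else 0 := by
  induction j with
  | zero =>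
    intro α b n L h0 h1 hb hn hbz hnz h he
    have e : shift 1 b = shift 1 n := funext fun i => he _ (by omega)
    rw [intVal_rec α hbz, intVal_rec α hnz, e]
    omega
  | succ j ih =>
    intro α b n L h0 h1 hb hn hbz hnz h he
    rcases h0.eq_or_lt with rfl | h0
    · have := hn.null_of_zero (j + 1)
      omega
    have hb' := hb.shift_one h0 h1
    have hn' := hn.shift_one h0 h1
    have key := ih (gaussIter_one_nonneg α) (gaussIter_one_lt_one α) hb' hn'
      (shift_one_eq_zero_of_le hbz) (shift_one_eq_zero_of_le hnz)
      (by rw [shift_apply, shift_apply, add_comm 1 j]; exact h)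
      (fun i hi => he _ (by omega))
    have eb := intVal_mul α hbz
    have en := intVal_mul α hnz
    have vb := hb.realVal_lt_one h0.le h1
    have vb2 := hb.neg_lt_realVal h0 h1
    have vn := hn.neg_lt_realVal h0 h1
    by_cases hlt : intVal (gaussIter α 1) (shift 1 b) < intVal (gaussIter α 1) (shift 1 n)
    · have hlt' : (intVal (gaussIter α 1) (shift 1 b) : ℝ) + 1
          ≤ intVal (gaussIter α 1) (shift 1 n) := by exact_mod_cast hlt
      by_cases hs : realVal α n < 0 ∧ 0 ≤ realVal α b
      · rw [if_pos hs]
        have : (intVal α b : ℝ) * α < (intVal α n + 1) * α := by linarith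
        exact_mod_cast lt_of_mul_lt_mul_right this h0.le
      · rw [if_neg hs]
        have hs' : realVal α b - 1 < realVal α n := by
          by_cases h3 : realVal α n < 0
          · have : realVal α b < 0 := by
              by_contra hc
              exact hs ⟨h3, not_lt.1 hc⟩
            linarith
          · linarith
        have : (intVal α b : ℝ) * α < intVal α n * α := by linarith
        exact_mod_cast lt_of_mul_lt_mul_right this h0.le
    -- The integer values of the shifts can only tie when the extra 1 is present. Then the first
    -- digit of n is maximal, and the real values decide.
    · split_ifs at key with hs
      · have heq : intVal (gaussIter α 1) (shift 1 b) = intVal (gaussIter α 1) (shift 1 n) := by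
          omega
        have hv : realVal α b < realVal α n := by
          rw [hb.realVal_eq h0 h1, hn.realVal_eq h0 h1, hn.eq_quot_of_shift_neg h0 h1 hs.1]
          have : (b 0 : ℝ) ≤ quot α 0 := by exact_mod_cast hb.le_quot 0
          exact mul_lt_mul_of_pos_left (by linarith) h0
        have : (intVal α b : ℝ) * α < intVal α n * α := by rw [eb, en, heq]; linarith
        have : intVal α b < intVal α n := by
          exact_mod_cast lt_of_mul_lt_mul_right this h0.le
        omega
      · omega

theorem ltR_iff_intVal_lt {α : ℝ} {b n : ℕ → ℕ} {L : ℕ} (h0 : 0 ≤ α) (h1 : α < 1)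
    (hb : IsPreadmissible α b) (hn : IsPreadmissible α n)
    (hbz : ∀ i, L ≤ i → b i = 0) (hnz : ∀ i, L ≤ i → n i = 0) :
    ltR b n ↔
      intVal α b < intVal α n + if realVal α n < 0 ∧ 0 ≤ realVal α b then 1 else 0 := by
  refine ⟨fun ⟨j, hj, he⟩ => intVal_lt_of_ltR j h0 h1 hb hn hbz hnz hj he, fun h => ?_⟩
  rcases ltR_trichotomy L hbz hnz with rfl | h' | ⟨j, hj, he⟩
  · exfalso
    split_ifs at h with h2
    · exact h2.1.not_ge h2.2
    · omega
  · exact h'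
  · exfalso
    have := intVal_lt_of_ltR j h0 h1 hn hb hnz hbz hj he
    split_ifs at h this with h2 h3
    · exact h2.1.not_ge h3.2
    all_goals omega

/-- The integers `m` below the bound with `m α ≡ β` modulo `1` are counted by the order `<_R`. -/
theorem sum_indicator_eq_ltR {α : ℝ} {b n : ℕ → ℕ} {L : ℕ} (h0 : 0 ≤ α) (h1 : α < 1)
    (hb : IsPreadmissible α b) (hn : IsPreadmissible α n) (hnz : ∀ i, L ≤ i → n i = 0) :
    open Classical in
    ∑ m ∈ Finset.range (intVal α n + if realVal α n < 0 ∧ 0 ≤ realVal α b then 1 else 0),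
      (if ∃ l : ℤ, (m : ℝ) * α - realVal α b = l then (1 : ℤ) else 0)
      = if ltR b n then 1 else 0 := by
  classical
  set M := intVal α n + if realVal α n < 0 ∧ 0 ≤ realVal α b then 1 else 0 with hM
  have hMle : M ≤ intVal α n + 1 := by rw [hM]; split_ifs <;> omega
  -- Here m is at most the integer value of n, which is below every denominator of α; so the descent
  -- applies.
  have uniq : ∀ m < M, (∃ l : ℤ, (m : ℝ) * α - realVal α b = l) →
      (∃ L, ∀ i, L ≤ i → b i = 0) ∧ intVal α b = m := by
    rintro m hm ⟨l, hl⟩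
    refine hb.exists_intVal_eq _ h0 h1 le_rfl hl fun k j hk hj => ?_
    have := hn.intVal_lt L h0 h1 hnz hk hj
    omega
  have common : ∀ L', (∀ i, L' ≤ i → b i = 0) → (ltR b n ↔ intVal α b < M) := fun L' hL' =>
    ltR_iff_intVal_lt (L := max L L') h0 h1 hb hn (fun i hi => hL' i (by omega))
      (fun i hi => hnz i (by omega))
  by_cases h : ltR b n
  · rw [if_pos h]
    obtain ⟨j, hj, he⟩ := h
    have hbz : ∀ i, max L (j + 1) ≤ i → b i = 0 := fun i hi => by
      rw [he i (by omega), hnz i (by omega)]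
    have hlt := (common _ hbz).1 ⟨j, hj, he⟩
    have hex : ∃ l : ℤ, ((intVal α b : ℕ) : ℝ) * α - realVal α b = l :=
      ⟨intVal (gaussIter α 1) (shift 1 b), by rw [intVal_mul α hbz]; push_cast; ring⟩
    rw [Finset.sum_eq_single (intVal α b), if_pos hex]
    · intro m hm hne
      rw [if_neg]
      exact fun hc => hne (uniq m (Finset.mem_range.1 hm) hc).2.symm
    · intro hc
      exact absurd (Finset.mem_range.2 hlt) hc
  · rw [if_neg h]
    refine Finset.sum_eq_zero fun m hm => if_neg fun hc => h ?_
    obtain ⟨⟨L', hL'⟩, e⟩ := uniq m (Finset.mem_range.1 hm) hc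
    exact (common L' hL').2 (e ▸ Finset.mem_range.1 hm)

/-! ### The signed count and its rows -/

/-- For `0 ≤ β < 1` this is `C(α, β, ν)`; for `-1 < β < 0` it is
`-#{k ∈ {0, …, ν - 1} : {k α} ≥ 1 + β}`. -/
noncomputable def signedCount (α β : ℝ) (ν : ℕ) : ℤ :=
  ∑ k ∈ Finset.range ν, (⌊(k : ℝ) * α⌋ - ⌊(k : ℝ) * α - β⌋)

theorem signedCount_succ (α β : ℝ) (ν : ℕ) :
    signedCount α β (ν + 1) = signedCount α β ν + (⌊(ν : ℝ) * α⌋ - ⌊(ν : ℝ) * α - β⌋) :=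
  Finset.sum_range_succ _ _

theorem signedCount_eq_add {α β : ℝ} {A B : ℕ} (hAB : A ≤ B) {c : ℤ}
    (h : ∀ k : ℕ, A ≤ k → k < B → ⌊(k : ℝ) * α⌋ - ⌊(k : ℝ) * α - β⌋ = c) :
    signedCount α β B = signedCount α β A + (B - A) * c := by
  rw [signedCount, signedCount, ← Finset.sum_range_add_sum_Ico _ hAB,
    Finset.sum_congr rfl fun k hk => h k (Finset.mem_Ico.1 hk).1 (Finset.mem_Ico.1 hk).2]
  simp [Nat.cast_sub hAB]

theorem ceil_div_le_iff {α : ℝ} (h0 : 0 < α) (x : ℝ) (k : ℕ) :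
    ⌈x / α⌉ ≤ (k : ℤ) ↔ x ≤ k * α := by
  rw [Int.ceil_le, div_le_iff₀ h0, Int.cast_natCast]

theorem lt_ceil_div_iff {α : ℝ} (h0 : 0 < α) (x : ℝ) (k : ℕ) :
    (k : ℤ) < ⌈x / α⌉ ↔ k * α < x := by
  rw [← not_le, ceil_div_le_iff h0, not_le]

theorem floor_sub_floor_eq {m j : ℤ} {x y : ℝ} (h1 : m ≤ x) (h2 : x < m + 1) (h3 : j ≤ y)
    (h4 : y < j + 1) : ⌊x⌋ - ⌊y⌋ = m - j := by
  rw [Int.floor_eq_iff.2 ⟨h1, h2⟩, Int.floor_eq_iff.2 ⟨h3, h4⟩]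

/-- The number of integers `k` with `m ≤ k α < m + β` (with sign), summed over `m < M`. -/
noncomputable def rowSum (α β : ℝ) (M : ℕ) : ℤ :=
  ∑ m ∈ Finset.range M, (⌈((m : ℝ) + β) / α⌉ - ⌈(m : ℝ) / α⌉)

/-- The limit ⌈M/α⌉ is where row M begins, so exactly the rows m < M are complete; in each, the
counted integers come first. -/
theorem signedCount_ceil_of_nonneg {α β : ℝ} (h0 : 0 < α) (hβ0 : 0 ≤ β)
    (hβ1 : β < 1) (M : ℕ) : ∀ {A : ℕ}, (A : ℤ) = ⌈(M : ℝ) / α⌉ →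
    signedCount α β A = rowSum α β M := by
  induction M with
  | zero =>
    intro A hA
    have : A = 0 := by simpa using hA
    simp [this, signedCount, rowSum]
  | succ M ih =>
    intro C hC
    have hM : (0 : ℝ) ≤ M := Nat.cast_nonneg _
    obtain ⟨A, hA⟩ := Int.eq_ofNat_of_zero_le (Int.ceil_nonneg (div_nonneg hM h0.le))
    obtain ⟨B, hB⟩ := Int.eq_ofNat_of_zero_le
      (Int.ceil_nonneg (div_nonneg (add_nonneg hM hβ0) h0.le))
    have hAB : ⌈(M : ℝ) / α⌉ ≤ ⌈((M : ℝ) + β) / α⌉ :=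
      Int.ceil_le_ceil (by gcongr; linarith)
    have hBC : ⌈((M : ℝ) + β) / α⌉ ≤ ⌈((M + 1 : ℕ) : ℝ) / α⌉ :=
      Int.ceil_le_ceil (by gcongr; push_cast; linarith)
    have e1 := signedCount_eq_add (α := α) (β := β) (A := A) (B := B) (c := 1) (by omega)
      (fun k h1 h2 => by
        have h1 := (ceil_div_le_iff h0 M k).1 (by omega)
        have h2 := (lt_ceil_div_iff h0 (M + β) k).1 (by omega)
        rw [floor_sub_floor_eq (m := M) (j := M - 1)] <;> push_cast <;> linarith)
    have e2 := signedCount_eq_add (α := α) (β := β) (A := B) (B := C) (c := 0) (by omega)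
      (fun k h1 h2 => by
        have h1 := (ceil_div_le_iff h0 (M + β) k).1 (by omega)
        have h2 := (lt_ceil_div_iff h0 (M + 1 : ℕ) k).1 (by omega)
        push_cast at h2
        rw [floor_sub_floor_eq (m := M) (j := M)] <;> push_cast <;> linarith)
    rw [rowSum, Finset.sum_range_succ, ← rowSum, ← ih hA.symm, e2, e1, hA, hB]
    ring

/-- For negative β the term with index m counts the k with m + β ≤ kα < m. These precede ⌈m/α⌉, so
the index m = M is included as well. Index 0 contributes nothing because -α < β. -/
theorem signedCount_ceil_of_neg {α β : ℝ} (h0 : 0 < α) (h1 : α < 1) (hβ0 : β < 0)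
    (hβ1 : -α < β) (M : ℕ) : ∀ {A : ℕ}, (A : ℤ) = ⌈(M : ℝ) / α⌉ →
    signedCount α β A = rowSum α β M + (⌈((M : ℝ) + β) / α⌉ - ⌈(M : ℝ) / α⌉) := by
  induction M with
  | zero =>
    intro A hA
    have : A = 0 := by simpa using hA
    have h2 : ⌈β / α⌉ = 0 := by
      rw [Int.ceil_eq_zero_iff]
      exact ⟨by rw [lt_div_iff₀ h0]; linarith, div_nonpos_of_nonpos_of_nonneg hβ0.le h0.le⟩
    simp [this, signedCount, rowSum, h2]
  | succ M ih =>
    intro C hC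
    have hM : (0 : ℝ) ≤ M := Nat.cast_nonneg _
    obtain ⟨A, hA⟩ := Int.eq_ofNat_of_zero_le (Int.ceil_nonneg (div_nonneg hM h0.le))
    obtain ⟨B, hB⟩ := Int.eq_ofNat_of_zero_le (a := ⌈(((M + 1 : ℕ) : ℝ) + β) / α⌉)
      (Int.ceil_nonneg (div_nonneg (by push_cast; linarith) h0.le))
    have hAB : ⌈(M : ℝ) / α⌉ ≤ ⌈(((M + 1 : ℕ) : ℝ) + β) / α⌉ :=
      Int.ceil_le_ceil (by gcongr; push_cast; linarith)
    have hBC : ⌈(((M + 1 : ℕ) : ℝ) + β) / α⌉ ≤ ⌈((M + 1 : ℕ) : ℝ) / α⌉ :=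
      Int.ceil_le_ceil (by gcongr; linarith)
    have e1 := signedCount_eq_add (α := α) (β := β) (A := A) (B := B) (c := 0) (by omega)
      (fun k h1 h2 => by
        have h1 := (ceil_div_le_iff h0 M k).1 (by omega)
        have h2 := (lt_ceil_div_iff h0 ((M + 1 : ℕ) + β) k).1 (by omega)
        push_cast at h2
        rw [floor_sub_floor_eq (m := M) (j := M)] <;> push_cast <;> linarith)
    have e2 := signedCount_eq_add (α := α) (β := β) (A := B) (B := C) (c := -1) (by omega)
      (fun k h1 h2 => by
        have h1 := (ceil_div_le_iff h0 ((M + 1 : ℕ) + β) k).1 (by omega)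
        have h2 := (lt_ceil_div_iff h0 (M + 1 : ℕ) k).1 (by omega)
        push_cast at h1 h2
        rw [floor_sub_floor_eq (m := M) (j := M + 1)] <;> push_cast <;> linarith)
    rw [rowSum, Finset.sum_range_succ, ← rowSum, e2, e1, ih hA.symm, hB, ← hC]
    ring

/-! ### Passage of the rows to the Gauss image -/

theorem ceil_eq_floor_add (x : ℝ) :
    open Classical in ⌈x⌉ = ⌊x⌋ + 1 - if ∃ l : ℤ, x = l then 1 else 0 := by
  classical
  split_ifs with h
  · obtain ⟨l, rfl⟩ := h
    simp
  · rw [sub_zero, Int.ceil_eq_floor_add_one_iff_notMem]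
    rintro ⟨l, hl⟩
    exact h ⟨l, hl.symm⟩

theorem ceil_add_div_eq {α α' β β' : ℝ} {a b : ℕ} (h0 : 0 < α) (hs : α * (a + α') = 1)
    (hβ : β = α * (b - β')) (m : ℕ) :
    ⌈((m : ℝ) + β) / α⌉ = m * a + b + ⌈(m : ℝ) * α' - β'⌉ := by
  have : ((m : ℝ) + β) / α = ((m * a + b : ℕ) : ℝ) + (m * α' - β') := by
    rw [div_eq_iff h0.ne', hβ]
    push_cast
    linear_combination (-(m : ℝ)) * hs
  rw [this, Int.ceil_natCast_add]
  push_cast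
  ring

theorem ceil_div_eq {α α' : ℝ} {a : ℕ} (h0 : 0 < α) (hs : α * (a + α') = 1) (m : ℕ) :
    ⌈(m : ℝ) / α⌉ = m * a + ⌈(m : ℝ) * α'⌉ := by
  simpa using ceil_add_div_eq (b := 0) (β := 0) (β' := 0) h0 hs (by simp) m

/-- The two indicator terms come from turning ceilings into floors. By hypothesis mα' is an integer
only for m = 0, whence the final 1. -/
theorem rowSum_eq {α α' β β' : ℝ} {a b M : ℕ} (h0 : 0 < α) (hs : α * (a + α') = 1)
    (hβ : β = α * (b - β')) (hM : ∀ m : ℕ, 0 < m → m < M → ∀ l : ℤ, (m : ℝ) * α' ≠ l) :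
    open Classical in
    rowSum α β M = b * M - signedCount α' β' M
      - ∑ m ∈ Finset.range M, (if ∃ l : ℤ, (m : ℝ) * α' - β' = l then (1 : ℤ) else 0)
      + if 0 < M then 1 else 0 := by
  classical
  induction M with
  | zero => simp [rowSum, signedCount]
  | succ M ih =>
    rw [rowSum, Finset.sum_range_succ, ← rowSum, ih fun m h1 h2 => hM m h1 (by omega),
      Finset.sum_range_succ, signedCount_succ, ceil_add_div_eq h0 hs hβ, ceil_div_eq h0 hs,
      ceil_eq_floor_add ((M : ℝ) * α' - β'), ceil_eq_floor_add ((M : ℝ) * α')]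
    rcases M.eq_zero_or_pos with rfl | hpos
    · have : ∃ l : ℤ, ((0 : ℕ) : ℝ) * α' = l := ⟨0, by simp⟩
      simp only [if_pos this]
      simp
      ring
    · have : ¬ ∃ l : ℤ, (M : ℝ) * α' = l := fun ⟨l, hl⟩ => hM M hpos (by omega) l hl
      rw [if_neg this, if_pos hpos, if_pos (by omega : 0 < M + 1)]
      push_cast
      ring

theorem floor_sub_floor_of_eq {N : ℕ} {N' : ℕ} {α β η : ℝ} (h : (N : ℝ) * α = N' + η) :
    ⌊(N : ℝ) * α⌋ - ⌊(N : ℝ) * α - β⌋ = ⌊η⌋ - ⌊η - β⌋ := by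
  rw [h, add_sub_assoc, Int.floor_natCast_add, Int.floor_natCast_add]
  ring

theorem ceil_sub_eq_ite {x y : ℝ} (h1 : x - y < 1) (h2 : y - x < 1) :
    ⌈x - y⌉ = if y < x then 1 else 0 := by
  split_ifs with h
  · rw [Int.ceil_eq_iff]; push_cast; constructor <;> linarith
  · rw [Int.ceil_eq_iff]; push_cast; constructor <;> linarith

/-! ### The incomplete last row -/

section

variable {α α' β β' η η' : ℝ} {a b n N N₁ N₂ : ℕ}

theorem neg_iff_digit_eq_zero (h0 : 0 < α) (hη : η = α * (n - η')) (hη'1 : η' < 1)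
    (hn0 : n = 0 → 0 < η') : η < 0 ↔ n = 0 := by
  constructor
  · intro h
    by_contra hc
    have : (1 : ℝ) ≤ n := by exact_mod_cast Nat.one_le_iff_ne_zero.2 hc
    nlinarith
  · rintro rfl
    have := hn0 rfl
    rw [hη]; push_cast; nlinarith

theorem pos_of_fractional_ne_zero (e2 : (N₁ : ℝ) * α' = N₂ + η') (hη'0 : -1 < η')
    (h : η' ≠ 0) : 0 < N₁ := by
  by_contra hc
  have hz : N₁ = 0 := by omega
  rw [hz] at e2
  push_cast at e2
  have : (N₂ : ℝ) < 1 := by linarith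
  have : N₂ = 0 := by
    have : N₂ < 1 := by exact_mod_cast this
    omega
  rw [this] at e2
  push_cast at e2
  exact h (by linarith)

theorem exists_eq_digit_add (h0 : 0 < α) (hs : α * (a + α') = 1) (hη : η = α * (n - η'))
    (e1 : (N : ℝ) * α = N₁ + η) (e2 : (N₁ : ℝ) * α' = N₂ + η') :
    ∃ K : ℕ, K = N₁ * a + N₂ ∧ N = n + K := by
  refine ⟨_, rfl, ?_⟩
  have : (N : ℝ) = n + (N₁ * a + N₂ : ℕ) := by
    push_cast
    refine mul_right_cancel₀ h0.ne' ?_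
    rw [e1, hη]
    linear_combination (-(N₁ : ℝ)) * hs + α * e2
  exact_mod_cast this

/-- Row N₁ begins at K + ⌈η'⌉, where N = n + K. For η' < 0 only k = N is missing from it; for η' = 0
it is row 0; for η' > 0 and n = 0 the raised limit N + 1 is its beginning; for η' > 0 and n > 0 its
n - 1 integers below N contribute min(n - 1, b - 1 + ⌈η' - β'⌉). The term with factor b accounts for
ν₁ = N₁ + 1 when the row sum stops at N₁. -/
theorem signedCount_eq_rowSum_of_nonneg (h0 : 0 < α) (h1 : α < 1) (hα'1 : α' < 1)
    (hs : α * (a + α') = 1) (hβ : β = α * (b - β')) (hη : η = α * (n - η'))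
    (hβ'0 : -α' < β') (hβ'1 : β' < 1) (hη'0 : -α' < η') (hη'1 : η' < 1)
    (hβ1 : β < 1) (hη1 : η < 1)
    (hba : b ≤ a) (hna : n ≤ a) (hb' : β' < 0 → b = a) (hn' : η' < 0 → n = a) (ha : 1 ≤ a)
    (hn0 : n = 0 → 0 < η') (e1 : (N : ℝ) * α = N₁ + η)
    (e2 : (N₁ : ℝ) * α' = N₂ + η') (hN₁ : η' = 0 → N₁ = 0) (hb1 : 1 ≤ b) (hβ0 : 0 ≤ β) :
    signedCount α β (N + if η < 0 ∧ 0 ≤ β then 1 else 0)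
      = rowSum α β (N₁ + if η' < 0 ∧ 0 ≤ β' then 1 else 0)
        + (b : ℤ) * (if η' < 0 ∧ β' < 0 then 1 else 0)
        - (if 0 < N₁ + (if η' < 0 ∧ 0 ≤ β' then 1 else 0) then 1 else 0)
        + (if n = 0 ∨ η' < 0 then 1 else ((min b n : ℕ) : ℤ))
        + (if b < n ∧ β' < η' then 1 else 0) := by
  have hη_iff := neg_iff_digit_eq_zero h0 hη hη'1 hn0
  have hN₁' := pos_of_fractional_ne_zero e2 (by linarith)
  obtain ⟨K, hK, hN⟩ := exists_eq_digit_add h0 hs hη e1 e2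
  have hA : ⌈(N₁ : ℝ) / α⌉ = K + ⌈η'⌉ := by
    rw [ceil_div_eq h0 hs, e2, Int.ceil_natCast_add, hK]; push_cast; ring
  have hA1 : η' < 0 → ⌈((N₁ + 1 : ℕ) : ℝ) / α⌉ = N + 1 := by
    intro h
    have : ⌈η' + α'⌉ = 1 := by
      rw [Int.ceil_eq_iff]; push_cast; constructor <;> linarith
    rw [ceil_div_eq h0 hs, show ((N₁ + 1 : ℕ) : ℝ) * α' = N₂ + (η' + α') by
      push_cast; linarith, Int.ceil_natCast_add, this, hN, hn' h, hK]
    push_cast; ring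
  have hX : ⌈((N₁ : ℝ) + β) / α⌉ = K + b + ⌈η' - β'⌉ := by
    rw [ceil_add_div_eq h0 hs hβ, e2, add_sub_assoc, Int.ceil_natCast_add, hK]; push_cast; ring
  rcases lt_trichotomy η' 0 with h' | h' | h'
  · -- the row `m = N₁` lacks exactly the integer `k = N`
    have hna' := hn' h'
    have hn1 : n ≠ 0 := by omega
    have hη0 : ¬ η < 0 := fun h => hn1 (hη_iff.1 h)
    have hN1 := hN₁' h'.ne
    rw [if_neg (fun h => hη0 h.1), add_zero, if_pos (Or.inr h')]
    have e3 := signedCount_ceil_of_nonneg h0 hβ0 hβ1 (N₁ + 1) (A := N + 1) (by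
      rw [hA1 h']; push_cast; ring)
    have e4 : ⌊η⌋ = 0 := Int.floor_eq_zero_iff.2 ⟨not_lt.1 hη0, hη1⟩
    rw [signedCount_succ, floor_sub_floor_of_eq e1, e4] at e3
    have hlt : η < β ↔ (n : ℝ) - η' < b - β' := by
      rw [hβ, hη, mul_lt_mul_iff_right₀ h0]
    by_cases hβ'2 : β' < 0
    · have hb := hb' hβ'2
      rw [if_neg (fun h => hβ'2.not_ge h.2), add_zero, if_pos ⟨h', hβ'2⟩, if_pos hN1,
        if_neg (by omega)]
      rw [rowSum, Finset.sum_range_succ, ← rowSum, hX,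
        hA, ceil_sub_eq_ite (by linarith) (by linarith)] at e3
      have e5 : ⌈η'⌉ = 0 := Int.ceil_eq_zero_iff.2 ⟨by linarith, h'.le⟩
      have e6 : ⌊η - β⌋ = if β' < η' then -1 else 0 := by
        have : η < β ↔ β' < η' := by
          rw [hlt, hna', hb]; constructor <;> intro h <;> linarith
        split_ifs with h
        · have := this.2 h
          rw [Int.floor_eq_iff]; push_cast
          constructor <;> linarith
        · have := mt this.1 h
          rw [Int.floor_eq_zero_iff]
          constructor <;> linarith
      rw [e5, e6] at e3
      split_ifs at e3 <;> linarith
    · have hb : (b : ℝ) ≤ n := by rw [hna']; exact_mod_cast hba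
      have e6 : ⌊η - β⌋ = 0 := by
        have := mt hlt.1 (by linarith)
        rw [Int.floor_eq_zero_iff]
        constructor <;> linarith
      rw [if_pos ⟨h', not_lt.1 hβ'2⟩, if_neg (fun h => hβ'2 h.2), if_pos (by omega),
        if_neg (fun h => hβ'2 (by linarith [h.2]))]
      rw [e6] at e3
      linarith
  all_goals
    have hnot : ¬ η' < 0 := by linarith
    simp only [hnot, false_and, or_false, if_false, add_zero, mul_zero]
    by_cases hn1 : n = 0
  · exact absurd (hn0 hn1) (by linarith)
  · have hη0 : ¬ η < 0 := fun h => hn1 (hη_iff.1 h)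
    have hz := hN₁ h'
    rw [if_neg (fun h => hη0 h.1), add_zero, if_neg (by omega), if_neg hn1]
    have hKN : K = 0 := by
      have e3 : ⌈(N₁ : ℝ) / α⌉ = 0 := by simp [hz]
      rw [hA, h', Int.ceil_zero] at e3
      omega
    have hX' : ⌈β / α⌉ = b + ⌈-β'⌉ := by
      have := hX
      rw [hz, hKN, h'] at this
      simpa using this
    have hc : (β' < 0 ∧ 0 ≤ ⌈-β'⌉) ∨ (¬ β' < 0 ∧ ⌈-β'⌉ = 0) := by
      by_cases h : β' < 0
      · exact .inl ⟨h, Int.ceil_nonneg (by linarith)⟩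
      · exact .inr ⟨h, Int.ceil_eq_zero_iff.2 ⟨by linarith, by linarith⟩⟩
    -- All k < N lie in row 0, where the condition is k < ⌈β/α⌉. That bound is b, or at least b if
    -- β' < 0; in the latter case b = a ≥ n.
    have hmin : ((min b n : ℕ) : ℤ) ≤ ⌈β / α⌉ ∧ (min b n < N → ⌈β / α⌉ ≤ (min b n : ℕ)) := by
      rw [hX']
      rcases hc with ⟨h, hc⟩ | ⟨h, hc⟩
      · have := hb' h
        omega
      · omega
    have e3 := signedCount_eq_add (α := α) (β := β) (A := 0) (B := min b n) (c := 1)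
      (Nat.zero_le _) (fun k _ hk => by
        have h2 := (lt_ceil_div_iff h0 β k).1 (by omega)
        have h3 : (0 : ℝ) ≤ k * α := by positivity
        rw [floor_sub_floor_eq (m := 0) (j := -1)] <;> push_cast <;> linarith)
    have e4 := signedCount_eq_add (α := α) (β := β) (A := min b n) (B := N) (c := 0)
      (by omega) (fun k hk hkN => by
        have h2 := (ceil_div_le_iff h0 β k).1 (by omega)
        have h3 : (0 : ℝ) ≤ k * α := by positivity
        have h4 : (k : ℝ) + 1 ≤ N := by exact_mod_cast hkN
        have h5 : (k : ℝ) * α < 1 := by rw [hz] at e1; push_cast at e1; nlinarith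
        rw [floor_sub_floor_eq (m := 0) (j := 0)] <;> push_cast <;> linarith)
    have hε : ¬ (b < n ∧ β' < η') := by
      rintro ⟨hbn, h⟩
      have := hb' (by linarith)
      omega
    rw [e4, e3, if_neg hε, hz]
    simp [signedCount, rowSum]
  · have hη0 : η < 0 := hη_iff.2 hn1
    have e5 : ⌈η'⌉ = 1 := by rw [Int.ceil_eq_iff]; push_cast; constructor <;> linarith
    rw [if_pos ⟨hη0, hβ0⟩, if_pos (hN₁' h'.ne'), if_pos hn1, if_neg (by omega),
      signedCount_ceil_of_nonneg h0 hβ0 hβ1 N₁ (by rw [hA, e5, hN, hn1]; push_cast; ring)]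
    ring
  · have hη0 : ¬ η < 0 := fun h => hn1 (hη_iff.1 h)
    have e5 : ⌈η'⌉ = 1 := by rw [Int.ceil_eq_iff]; push_cast; constructor <;> linarith
    rw [if_neg (fun h => hη0 h.1), add_zero, if_pos (hN₁' h'.ne'), if_neg hn1]
    have hc : (β' < 0 ∧ 1 ≤ ⌈η' - β'⌉) ∨
        (¬ β' < 0 ∧ ⌈η' - β'⌉ = if β' < η' then 1 else 0) := by
      by_cases h : β' < 0
      · exact .inl ⟨h, Int.one_le_ceil_iff.2 (by linarith)⟩
      · exact .inr ⟨h, ceil_sub_eq_ite (by linarith) (by linarith)⟩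
    -- B is the end of the counted part of row N₁, cut off at N.
    obtain ⟨B, hB⟩ : ∃ B : ℕ, B = min N (⌈((N₁ : ℝ) + β) / α⌉).toNat := ⟨_, rfl⟩
    have hAX : (K : ℤ) + 1 ≤ ⌈((N₁ : ℝ) + β) / α⌉ := by
      rw [← e5, ← hA]
      exact Int.ceil_le_ceil (by gcongr; linarith)
    have e2' := signedCount_ceil_of_nonneg h0 hβ0 hβ1 N₁ (A := K + 1)
      (by rw [hA, e5]; push_cast; ring)
    have e3 := signedCount_eq_add (α := α) (β := β) (A := K + 1) (B := B) (c := 1)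
      (by omega) (fun k hk hkB => by
        have h2 := (lt_ceil_div_iff h0 (N₁ + β) k).1 (by omega)
        have h3 := (ceil_div_le_iff h0 N₁ k).1 (by omega)
        rw [floor_sub_floor_eq (m := N₁) (j := N₁ - 1)] <;> push_cast <;> linarith)
    have e4 := signedCount_eq_add (α := α) (β := β) (A := B) (B := N) (c := 0)
      (by omega) (fun k hk hkN => by
        have h2 := (ceil_div_le_iff h0 (N₁ + β) k).1 (by omega)
        have h4 : (k : ℝ) + 1 ≤ N := by exact_mod_cast hkN
        have h5 : (k : ℝ) * α < N₁ + 1 := by nlinarith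
        rw [floor_sub_floor_eq (m := N₁) (j := N₁)] <;> push_cast <;> linarith)
    rw [e4, e3, e2']
    rw [hX] at hB hAX
    rcases hc with ⟨h, hc⟩ | ⟨h, hc⟩
    · have := hb' h
      rw [if_neg (by omega : ¬ (b < n ∧ β' < η'))]
      push_cast
      omega
    · rw [hc] at hB hAX
      by_cases h2 : β' < η'
      · simp only [h2, and_true, if_true] at hB hAX ⊢
        split_ifs <;> push_cast <;> omega
      · simp only [h2, and_false, if_false] at hB hAX ⊢
        push_cast
        omega

/-- Now the counted integers sit at the end of a row. For n > 0 and η' ≥ 0 the limit N cuts row N₁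
before reaching them; in the other cases the complete count reaches N + 1, and the single term k = N
is removed. -/
theorem signedCount_eq_rowSum_of_neg (h0 : 0 < α) (h1 : α < 1) (hα'1 : α' < 1)
    (hs : α * (a + α') = 1) (hβ : β = α * (b - β')) (hη : η = α * (n - η'))
    (hβ'0 : 0 < β') (hβ'1 : β' < 1) (hη'0 : -α' < η') (hη'1 : η' < 1)
    (hη0 : -α < η) (hη1 : η < 1)
    (hn' : η' < 0 → n = a) (ha : 1 ≤ a)
    (hn0 : n = 0 → 0 < η') (e1 : (N : ℝ) * α = N₁ + η)
    (e2 : (N₁ : ℝ) * α' = N₂ + η') (hN₁ : η' = 0 → N₁ = 0) (hb0 : b = 0) (hβ0 : -α < β) :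
    signedCount α β (N + if η < 0 ∧ 0 ≤ β then 1 else 0)
      = rowSum α β (N₁ + if η' < 0 ∧ 0 ≤ β' then 1 else 0)
        + (b : ℤ) * (if η' < 0 ∧ β' < 0 then 1 else 0)
        - (if 0 < N₁ + (if η' < 0 ∧ 0 ≤ β' then 1 else 0) then 1 else 0)
        + (if n = 0 ∨ η' < 0 then 1 else ((min b n : ℕ) : ℤ))
        + (if b < n ∧ β' < η' then 1 else 0) := by
  have hβneg : β < 0 := by rw [hβ, hb0]; push_cast; nlinarith
  have hη_iff := neg_iff_digit_eq_zero h0 hη hη'1 hn0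
  have hN₁' := pos_of_fractional_ne_zero e2 (by linarith)
  obtain ⟨K, hK, hN⟩ := exists_eq_digit_add h0 hs hη e1 e2
  have hA : ⌈(N₁ : ℝ) / α⌉ = K + ⌈η'⌉ := by
    rw [ceil_div_eq h0 hs, e2, Int.ceil_natCast_add, hK]; push_cast; ring
  have hX : ⌈((N₁ : ℝ) + β) / α⌉ = K + ⌈η' - β'⌉ := by
    rw [ceil_add_div_eq h0 hs hβ, e2, add_sub_assoc, Int.ceil_natCast_add, hK, hb0]
    push_cast; ring
  have hnβ : ¬ 0 ≤ β := hβneg.not_ge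
  have hnβ' : ¬ β' < 0 := hβ'0.not_gt
  simp only [hnβ, hnβ', and_false, if_false, add_zero, hβ'0.le, and_true, mul_zero, hb0,
    Nat.zero_min, Nat.cast_zero]
  rcases lt_trichotomy η' 0 with h' | h' | h'
  · have hna' := hn' h'
    have hη0 : ¬ η < 0 := fun h => by have := hη_iff.1 h; omega
    have hlt : 1 + β ≤ η ↔ η' + α' ≤ β' := by
      rw [hβ, hη, hb0, hna', ← hs]
      push_cast
      rw [show α * (a + α') + α * (0 - β') = α * (a + α' - β') by ring,
        mul_le_mul_iff_right₀ h0]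
      constructor <;> intro h <;> linarith
    have hc1 : ⌈η' + α'⌉ = 1 := by
      rw [Int.ceil_eq_iff]; push_cast; constructor <;> linarith
    have e3 := signedCount_ceil_of_neg h0 h1 hβneg hβ0 (N₁ + 1) (A := N + 1) (by
      rw [ceil_div_eq h0 hs, show ((N₁ + 1 : ℕ) : ℝ) * α' = N₂ + (η' + α') by
        push_cast; linarith, Int.ceil_natCast_add, hc1, hN, hna', hK]
      push_cast; ring)
    rw [ceil_add_div_eq h0 hs hβ, ceil_div_eq h0 hs,
      show ((N₁ + 1 : ℕ) : ℝ) * α' - β' = N₂ + (η' + α' - β') by push_cast; linarith,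
      show ((N₁ + 1 : ℕ) : ℝ) * α' = N₂ + (η' + α') by push_cast; linarith,
      Int.ceil_natCast_add, Int.ceil_natCast_add, hc1, hb0,
      ceil_sub_eq_ite (by linarith) (by linarith), signedCount_succ,
      floor_sub_floor_of_eq e1, Int.floor_eq_zero_iff.2 ⟨not_lt.1 hη0, hη1⟩] at e3
    have e6 : ⌊η - β⌋ = if β' < η' + α' then 0 else 1 := by
      split_ifs with h
      · have := mt hlt.1 h.not_ge
        rw [Int.floor_eq_zero_iff]
        constructor <;> linarith
      · have := hlt.2 (not_lt.1 h)
        rw [Int.floor_eq_iff]; push_cast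
        constructor <;> linarith
    rw [e6] at e3
    simp only [h', if_true, or_true]
    rw [if_pos (by omega), if_neg (fun h => by linarith [h.2])]
    split_ifs at e3 <;> push_cast at e3 <;> linarith
  all_goals
    have hnot : ¬ η' < 0 := by linarith
    simp only [hnot, or_false, if_false, add_zero]
    by_cases hn1 : n = 0
  · exact absurd (hn0 hn1) (by linarith)
  · have hz := hN₁ h'
    have hKN : K = 0 := by
      have e3 : ⌈(N₁ : ℝ) / α⌉ = 0 := by simp [hz]
      rw [hA, h', Int.ceil_zero] at e3
      omega
    have e4 := signedCount_eq_add (α := α) (β := β) (A := 0) (B := N) (c := 0)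
      (by omega) (fun k hk hkN => by
        have h3 : (0 : ℝ) ≤ k * α := by positivity
        have h4 : (k : ℝ) + 1 ≤ N := by exact_mod_cast hkN
        have h5 : (k : ℝ) * α < 1 + β := by rw [hz] at e1; push_cast at e1; nlinarith
        rw [floor_sub_floor_eq (m := 0) (j := 0)] <;> push_cast <;> linarith)
    have hε : ¬ (0 < n ∧ β' < η') := fun h => by linarith [h.2]
    rw [e4, hz, if_neg hn1, if_neg hε]
    simp [signedCount, rowSum]
  · have hη0 : η < 0 := hη_iff.2 hn1
    have e5 : ⌈η'⌉ = 1 := by rw [Int.ceil_eq_iff]; push_cast; constructor <;> linarith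
    have e3 := signedCount_ceil_of_neg h0 h1 hβneg hβ0 N₁ (A := N + 1)
      (by rw [hA, e5, hN, hn1]; push_cast; ring)
    have e4 : ⌊η⌋ = -1 := by
      rw [Int.floor_eq_iff]; push_cast; constructor <;> linarith
    have hlt : η < β ↔ β' < η' := by
      rw [hβ, hη, hb0, hn1, mul_lt_mul_iff_right₀ h0]
      constructor <;> intro h <;> linarith
    have e6 : ⌊η - β⌋ = if β' < η' then -1 else 0 := by
      split_ifs with h
      · have := hlt.2 h
        rw [Int.floor_eq_iff]; push_cast
        constructor <;> linarith
      · have := mt hlt.1 h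
        rw [Int.floor_eq_zero_iff]
        constructor <;> linarith
    rw [signedCount_succ, floor_sub_floor_of_eq e1, hX, hA, e4, e5, e6,
      ceil_sub_eq_ite (by linarith) (by linarith)] at e3
    rw [if_pos (hN₁' h'.ne'), if_pos hn1, if_neg (by omega)]
    split_ifs at e3 <;> linarith
  · have hη0 : ¬ η < 0 := fun h => hn1 (hη_iff.1 h)
    have e5 : ⌈η'⌉ = 1 := by rw [Int.ceil_eq_iff]; push_cast; constructor <;> linarith
    have e3 := signedCount_ceil_of_neg h0 h1 hβneg hβ0 N₁ (A := K + 1)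
      (by rw [hA, e5]; push_cast; ring)
    have e4 := signedCount_eq_add (α := α) (β := β) (A := K + 1) (B := N) (c := 0)
      (by omega) (fun k hk hkN => by
        have h3 := (ceil_div_le_iff h0 N₁ k).1 (by omega)
        have h4 : (k : ℝ) + 1 ≤ N := by exact_mod_cast hkN
        have h5 : (k : ℝ) * α < N₁ + (1 + β) := by nlinarith
        rw [floor_sub_floor_eq (m := N₁) (j := N₁)] <;> push_cast <;> linarith)
    rw [e4, e3, hX, hA, e5, ceil_sub_eq_ite (by linarith) (by linarith),
      if_pos (hN₁' h'.ne'), if_neg hn1]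
    have hnp : 0 < n := by omega
    simp only [hnp, true_and]
    ring

end

/-! ### Behaviour of ν_k, τ, ε and ε' under the shift -/

theorem nuSeq_succ_eq {α : ℝ} {n : ℕ → ℕ} {ν ν' : ℕ} (h : nuSeq α n ν 1 = ν') (k : ℕ) :
    nuSeq α n ν (k + 1) = nuSeq (gaussIter α 1) (shift 1 n) ν' k := by
  induction k with
  | zero => rw [h, nuSeq]
  | succ k ih =>
    rw [nuSeq, ih, nuSeq, gaussIter_succ_eq α k, shift_one_shift, shift_apply,
      show 1 + (k + 1) = k + 1 + 1 by ring]

/-- From Nα = N' + η with -α < η < 1 the floor is N', also after adding α when η < 0. The rule for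
adding 1 is exactly the condition η' < 0. -/
theorem nuSeq_one_eq {α : ℝ} {n : ℕ → ℕ} {L : ℕ} (h0 : 0 < α) (h1 : α < 1)
    (hn : IsPreadmissible α n) (hnz : ∀ i, L ≤ i → n i = 0) :
    nuSeq α n (intVal α n + if realVal α n < 0 then 1 else 0) 1
      = ((intVal (gaussIter α 1) (shift 1 n)
        + if realVal (gaussIter α 1) (shift 1 n) < 0 then 1 else 0 : ℕ) : ℤ) := by
  have hiff := (hn.shift_one h0 h1).realVal_neg_iff (gaussIter_one_nonneg _)
    (gaussIter_one_lt_one _)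
  have e := intVal_mul α hnz
  have v1 := hn.realVal_lt_one h0.le h1
  have v0 := hn.neg_lt_realVal h0 h1
  have hfl : ⌊((intVal α n + if realVal α n < 0 then 1 else 0 : ℕ) : ℝ) * α⌋
      = intVal (gaussIter α 1) (shift 1 n) := by
    rw [Int.floor_eq_iff]
    split_ifs with h
    · push_cast
      constructor <;> linarith
    · push_cast
      constructor <;> linarith
  have hg : gaussIter α 0 = α := rfl
  rw [nuSeq, nuSeq, Int.cast_natCast, hg, hfl]
  rw [shift_apply] at hiff
  by_cases h : realVal (gaussIter α 1) (shift 1 n) < 0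
  · obtain ⟨h2, h3⟩ := hiff.1 h
    rw [if_pos h, if_neg (by rintro (h4 | h4) <;> contradiction)]
    push_cast
    ring
  · rw [if_neg h, if_pos]
    · simp
    · by_contra hc
      push Not at hc
      exact h (hiff.2 hc)

theorem shift_one_apply (d : ℕ → ℕ) (i : ℕ) : shift 1 d i = d (i + 1) := by
  rw [shift_apply, add_comm]

theorem tau_succ (b n : ℕ → ℕ) (i : ℕ) :
    tau b n (i + 1) = tau (shift 1 b) (shift 1 n) i := by
  rw [tau, tau, shift_one_shift, shift_one_apply, shift_one_apply, shift_one_apply]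

theorem eps_succ (b n : ℕ → ℕ) (i : ℕ) :
    eps b n (i + 1) = eps (shift 1 b) (shift 1 n) i := by
  rw [eps, eps, shift_one_shift, shift_one_shift, shift_one_apply, shift_one_apply]

theorem eps'_succ (b n : ℕ → ℕ) (i : ℕ) :
    eps' b n (i + 1) = eps' (shift 1 b) (shift 1 n) i := by
  rw [eps', eps', shift_one_shift, shift_one_shift]

theorem signedCount_zero (α : ℝ) (ν : ℕ) : signedCount α 0 ν = 0 := by
  simp [signedCount]

/-! ### The induction along the Gauss map -/

/-- One step of the recursion when the Gauss map does not vanish. -/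
theorem signedCount_add_signedCount {α : ℝ} {b n : ℕ → ℕ} {L : ℕ} (h0 : 0 < α) (h1 : α < 1)
    (hg : 0 < gaussIter α 1) (hb : IsPreadmissible α b) (hn : IsPreadmissible α n)
    (hnz : ∀ i, L ≤ i → n i = 0) (hb0 : ¬ IsNull b) (hn0 : ¬ IsNull n) :
    signedCount α (realVal α b)
        (intVal α n + if realVal α n < 0 ∧ 0 ≤ realVal α b then 1 else 0)
      + signedCount (gaussIter α 1) (realVal (gaussIter α 1) (shift 1 b))
        (intVal (gaussIter α 1) (shift 1 n)
          + if realVal (gaussIter α 1) (shift 1 n) < 0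
            ∧ 0 ≤ realVal (gaussIter α 1) (shift 1 b) then 1 else 0)
      = (b 0 : ℤ) * ((intVal (gaussIter α 1) (shift 1 n)
          + if realVal (gaussIter α 1) (shift 1 n) < 0 then 1 else 0 : ℕ) : ℤ)
        + tau b n 0 + eps b n 0 - eps' b n 0 := by
  classical
  obtain ⟨ha, hs⟩ := gauss_step h0 h1
  have hs : α * (quot α 0 + gaussIter α 1) = 1 := by
    rcases hs with ⟨_, h⟩ | ⟨h, _⟩
    · exact h
    · exact absurd h hg.ne'
  have hg1 := gaussIter_one_lt_one α
  have hb' := hb.shift_one h0 h1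
  have hn' := hn.shift_one h0 h1
  have hnz' := shift_one_eq_zero_of_le hnz
  have e2 := intVal_mul (gaussIter α 1) hnz'
  have hN₁ : realVal (gaussIter α 1) (shift 1 n) = 0 →
      intVal (gaussIter α 1) (shift 1 n) = 0 := fun h =>
    intVal_of_null ((hn'.realVal_eq_zero_iff hg.le hg1).1 h)
  have key : signedCount α (realVal α b)
        (intVal α n + if realVal α n < 0 ∧ 0 ≤ realVal α b then 1 else 0)
      = rowSum α (realVal α b) (intVal (gaussIter α 1) (shift 1 n)
          + if realVal (gaussIter α 1) (shift 1 n) < 0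
            ∧ 0 ≤ realVal (gaussIter α 1) (shift 1 b) then 1 else 0)
        + (b 0 : ℤ) * (if realVal (gaussIter α 1) (shift 1 n) < 0
            ∧ realVal (gaussIter α 1) (shift 1 b) < 0 then 1 else 0)
        - (if 0 < intVal (gaussIter α 1) (shift 1 n)
            + (if realVal (gaussIter α 1) (shift 1 n) < 0
              ∧ 0 ≤ realVal (gaussIter α 1) (shift 1 b) then 1 else 0) then 1 else 0)
        + (if n 0 = 0 ∨ realVal (gaussIter α 1) (shift 1 n) < 0 then 1
            else ((min (b 0) (n 0) : ℕ) : ℤ))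
        + (if b 0 < n 0 ∧ realVal (gaussIter α 1) (shift 1 b)
            < realVal (gaussIter α 1) (shift 1 n) then 1 else 0) := by
    by_cases hbz : b 0 = 0
    · exact signedCount_eq_rowSum_of_neg h0 h1 hg1 hs (hb.realVal_eq h0 h1)
        (hn.realVal_eq h0 h1) (hb.realVal_shift_pos h0 h1 hbz hb0) (hb'.realVal_lt_one hg.le hg1)
        (hn'.neg_lt_realVal hg hg1) (hn'.realVal_lt_one hg.le hg1) (hn.neg_lt_realVal h0 h1)
        (hn.realVal_lt_one h0.le h1) (hn.eq_quot_of_shift_neg h0 h1) ha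
        (fun h => hn.realVal_shift_pos h0 h1 h hn0) (intVal_mul α hnz) e2 hN₁ hbz
        (hb.neg_lt_realVal h0 h1)
    · exact signedCount_eq_rowSum_of_nonneg h0 h1 hg1 hs (hb.realVal_eq h0 h1)
        (hn.realVal_eq h0 h1) (hb'.neg_lt_realVal hg hg1) (hb'.realVal_lt_one hg.le hg1)
        (hn'.neg_lt_realVal hg hg1) (hn'.realVal_lt_one hg.le hg1) (hb.realVal_lt_one h0.le h1)
        (hn.realVal_lt_one h0.le h1) (hb.le_quot 0) (hn.le_quot 0)
        (hb.eq_quot_of_shift_neg h0 h1) (hn.eq_quot_of_shift_neg h0 h1) ha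
        (fun h => hn.realVal_shift_pos h0 h1 h hn0) (intVal_mul α hnz) e2 hN₁
        (Nat.one_le_iff_ne_zero.2 hbz) (hb.realVal_pos h0 h1 hbz).le
  have hτ : tau b n 0 = if n 0 = 0 ∨ realVal (gaussIter α 1) (shift 1 n) < 0 then 1
      else ((min (b 0) (n 0) : ℕ) : ℤ) := by
    have hiff := hn'.realVal_neg_iff hg.le hg1
    rw [shift_apply] at hiff
    have : (n 0 * n (0 + 1) = 0 ∧ ¬ IsNull (shift (0 + 1) n))
        ↔ (n 0 = 0 ∨ realVal (gaussIter α 1) (shift 1 n) < 0) := by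
      rw [hiff, Nat.mul_eq_zero]
      constructor
      · rintro ⟨h | h, h2⟩
        · exact .inl h
        · exact .inr ⟨h, h2⟩
      · rintro (h | h)
        · exact ⟨.inl h, fun h2 => hn.shift_ne_zero h0 h1 h hn0 (h2 0)⟩
        · exact ⟨.inr h.1, h.2⟩
    rw [tau]
    simp only [this]
  have hε : eps b n 0 = if b 0 < n 0 ∧ realVal (gaussIter α 1) (shift 1 b)
      < realVal (gaussIter α 1) (shift 1 n) then 1 else 0 := by
    rw [eps]
    simp only [zero_add, ltA_iff hg.le hg1 hb' hn']
  have hε' : eps' b n 0 = if ltR (shift 1 b) (shift 1 n) then 1 else 0 := rfl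
  rw [hτ, hε, hε', ← sum_indicator_eq_ltR hg.le hg1 hb' hn' hnz', key,
    rowSum_eq h0 hs (hb.realVal_eq h0 h1)]
  · have : ((intVal (gaussIter α 1) (shift 1 n)
          + if realVal (gaussIter α 1) (shift 1 n) < 0 then 1 else 0 : ℕ) : ℤ)
        = ((intVal (gaussIter α 1) (shift 1 n)
          + if realVal (gaussIter α 1) (shift 1 n) < 0
            ∧ 0 ≤ realVal (gaussIter α 1) (shift 1 b) then 1 else 0 : ℕ) : ℤ)
          + if realVal (gaussIter α 1) (shift 1 n) < 0
            ∧ realVal (gaussIter α 1) (shift 1 b) < 0 then 1 else 0 := by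
      by_cases h : realVal (gaussIter α 1) (shift 1 n) < 0
      · by_cases h2 : realVal (gaussIter α 1) (shift 1 b) < 0
        · simp [h, h2]
        · simp [h, h2, not_lt.1 h2]
      · simp [h]
    rw [this]
    ring
  -- An integral mα' would force the integer value of σ(n) below m, while m is at most that value.
  · intro m hm hlt l hl
    have := hn'.intVal_lt L hg.le hg1 hnz' hm hl
    split_ifs at hlt <;> omega

/-- With α = 1/(a + 1) all k < n stay in row 0, where kα < αb means k < b. -/
theorem signedCount_terminal {α : ℝ} {a b n : ℕ} (h0 : 0 < α) (hs : α * (a + 1) = 1)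
    (hb : b ≤ a) (hn : n ≤ a) : signedCount α (α * b) n = (min b n : ℕ) := by
  have hb' : (b : ℝ) ≤ a := by exact_mod_cast hb
  have hk : ∀ k : ℕ, k < n → (k : ℝ) * α < 1 := fun k hk => by
    have : (k : ℝ) ≤ a := by exact_mod_cast hk.le.trans hn
    nlinarith
  have e1 := signedCount_eq_add (α := α) (β := α * b) (A := 0) (B := min b n) (c := 1)
    (Nat.zero_le _) (fun k _ hkB => by
      have h2 : (k : ℝ) + 1 ≤ b := by exact_mod_cast (by omega : k + 1 ≤ b)
      have h3 : (0 : ℝ) ≤ k * α := by positivity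
      have := hk k (by omega)
      rw [floor_sub_floor_eq (m := 0) (j := -1)] <;> push_cast <;> nlinarith)
  have e2 := signedCount_eq_add (α := α) (β := α * b) (A := min b n) (B := n) (c := 0)
    (by omega) (fun k hkA hkB => by
      have h2 : (b : ℝ) ≤ k := by exact_mod_cast (by omega : b ≤ k)
      have h3 : (0 : ℝ) ≤ k * α := by positivity
      have := hk k (by omega)
      rw [floor_sub_floor_eq (m := 0) (j := 0)] <;> push_cast <;> nlinarith)
  rw [e2, e1]
  simp [signedCount]

theorem digit_sum_eq_signedCount (s : ℕ) : ∀ {α : ℝ} {b n : ℕ → ℕ} {L : ℕ}, 0 ≤ α → α < 1 →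
    IsPreadmissible α b → IsPreadmissible α n → (∀ i, L ≤ i → n i = 0) →
    (IsNull (shift s n) ∨ IsNull (shift s b)) →
    (∀ j < s, ¬ IsNull (shift j n) ∧ ¬ IsNull (shift j b)) →
    ∑ i ∈ Finset.range s, (-1 : ℤ) ^ i *
        ((b i : ℤ) * nuSeq α n (intVal α n + if realVal α n < 0 then 1 else 0) (i + 1)
          + tau b n i + eps b n i - eps' b n i)
      = signedCount α (realVal α b)
        (intVal α n + if realVal α n < 0 ∧ 0 ≤ realVal α b then 1 else 0) := by
  have hshift0 : ∀ d : ℕ → ℕ, shift 0 d = d := fun d => funext fun i => by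
    rw [shift_apply, zero_add]
  induction s with
  | zero =>
    intro α b n L _ _ _ _ _ hs _
    rw [hshift0, hshift0] at hs
    rw [Finset.sum_range_zero]
    rcases hs with h | h
    · simp [intVal_of_null h, realVal_of_null h, signedCount]
    · rw [realVal_of_null h, signedCount_zero]
  | succ s ih =>
    intro α b n L h0 h1 hb hn hnz hs hlt
    have hnull := hlt 0 (by omega)
    rw [hshift0, hshift0] at hnull
    rcases h0.eq_or_lt with rfl | h0
    · exact absurd hn.null_of_zero hnull.1
    have hν := nuSeq_one_eq h0 h1 hn hnz
    have IH := ih (gaussIter_one_nonneg α) (gaussIter_one_lt_one α) (hb.shift_one h0 h1)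
      (hn.shift_one h0 h1) (shift_one_eq_zero_of_le hnz)
      (by rwa [shift_one_shift, shift_one_shift])
      (fun j hj => by rw [shift_one_shift, shift_one_shift]; exact hlt _ (by omega))
    rw [Finset.sum_range_succ']
    have hterm : ∀ i, (-1 : ℤ) ^ (i + 1) *
        ((b (i + 1) : ℤ) * nuSeq α n (intVal α n + if realVal α n < 0 then 1 else 0) (i + 1 + 1)
          + tau b n (i + 1) + eps b n (i + 1) - eps' b n (i + 1))
        = -((-1 : ℤ) ^ i * ((shift 1 b i : ℤ) * nuSeq (gaussIter α 1) (shift 1 n)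
          (intVal (gaussIter α 1) (shift 1 n)
            + if realVal (gaussIter α 1) (shift 1 n) < 0 then 1 else 0) (i + 1)
          + tau (shift 1 b) (shift 1 n) i + eps (shift 1 b) (shift 1 n) i
          - eps' (shift 1 b) (shift 1 n) i)) := fun i => by
      rw [nuSeq_succ_eq hν, tau_succ, eps_succ, eps'_succ, shift_apply, add_comm 1 i, pow_succ]
      ring
    simp only [hterm]
    rw [Finset.sum_neg_distrib, IH, zero_add, hν]
    -- If the Gauss image is 0, only the first digits survive and the step is the terminal count;
    -- otherwise one recursion step applies.
    rcases (gaussIter_one_nonneg α).eq_or_lt with hg | hg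
    · have bnull := hb.null_shift h0 h1 hg.symm
      have nnull := hn.null_shift h0 h1 hg.symm
      have hz : ∀ i, 1 ≤ i → n i = 0 := fun i hi => by
        have := nnull (i - 1)
        rwa [shift_apply, show 1 + (i - 1) = i by omega] at this
      have hsn : 0 < n 0 := by
        by_contra hc
        refine hnull.1 fun i => ?_
        rcases i.eq_zero_or_pos with rfl | hi
        · omega
        · exact hz i hi
      have hn0 : ¬ realVal α n < 0 := (hn.realVal_pos h0 h1 hsn.ne').not_gt
      have hN : intVal α n = n 0 := by
        rw [intVal_eq_sum α hz]
        simp [convDen]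
      have hs : α * (quot α 0 + 1) = 1 := by
        rcases (gauss_step h0 h1).2 with ⟨h, _⟩ | ⟨_, h⟩
        · exact absurd hg h.ne
        · exact h
      have hτ : tau b n 0 = (min (b 0) (n 0) : ℕ) :=
        if_neg fun h => h.2 nnull
      have hε : eps b n 0 = 0 := if_neg fun ⟨_, j, hj, _⟩ => by
        rw [zero_add, bnull j, nnull j] at hj
        exact lt_irrefl _ hj
      have hε' : eps' b n 0 = 0 := if_neg fun ⟨j, hj, _⟩ => by
        rw [zero_add, bnull j, nnull j] at hj
        exact lt_irrefl _ hj
      have hvb : realVal α b = α * b 0 := by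
        rw [hb.realVal_eq h0 h1, realVal_of_null bnull, sub_zero]
      have hno : ¬ (realVal α n < 0 ∧ 0 ≤ realVal α b) := fun h => hn0 h.1
      rw [intVal_of_null nnull, realVal_of_null nnull, realVal_of_null bnull, signedCount_zero,
        hτ, hε, hε', if_neg hno, hvb, hN, add_zero (n 0), signedCount_terminal h0 hs (hb.le_quot 0) (hn.le_quot 0)]
      simp
    · rw [pow_zero, one_mul, ← signedCount_add_signedCount h0 h1 hg hb hn hnz hnull.2 hnull.1]
      ring

/-! ### Admissible sequences and the unsigned count -/

/-- Euclid's algorithm: if kα = l, then lα' is an integer and l < k. -/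
theorem exists_gaussIter_eq_zero (k : ℕ) : ∀ {α : ℝ} {l : ℤ}, 0 ≤ α → α < 1 → 0 < k →
    k * α = l → ∃ t, gaussIter α t = 0 := by
  induction k using Nat.strong_induction_on with
  | _ k ih =>
  intro α l h0 h1 hk hl
  rcases h0.eq_or_lt with rfl | h0
  · exact ⟨0, rfl⟩
  have hk' : (0 : ℝ) < k := by exact_mod_cast hk
  have hl0 : 0 < l := by
    have : (0 : ℝ) < l := by rw [← hl]; positivity
    exact_mod_cast this
  lift l to ℕ using hl0.le
  push_cast at hl
  have hlk : l < k := by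
    have : (l : ℝ) < k := by rw [← hl]; nlinarith
    exact_mod_cast this
  obtain ⟨t, ht⟩ := ih l hlk (l := k - l * ⌊1 / α⌋) (gaussIter_one_nonneg α)
    (gaussIter_one_lt_one α) (by exact_mod_cast hl0) (by
      have : gaussIter α 1 = 1 / α - ⌊1 / α⌋ := rfl
      rw [this]
      push_cast
      rw [mul_sub, ← hl]
      field_simp)
  exact ⟨t + 1, by rw [gaussIter_succ_eq, ht]⟩

theorem quot_eq_zero_of_gaussIter {α : ℝ} {t : ℕ} (h : gaussIter α t = 0) (i : ℕ) :
    quot α (t + i) = 0 := by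
  have : gaussIter α (t + i) = 0 := by
    induction i with
    | zero => exact h
    | succ i ih => rw [← add_assoc, gaussIter, ih]; simp
  rw [quot, if_pos this]

theorem irrational_of_quot_pos {α : ℝ} (h0 : 0 ≤ α) (h1 : α < 1) {m : ℕ}
    (h : ∀ t, 0 < quot α (m + 2 * t)) : Irrational α := by
  rintro ⟨r, rfl⟩
  obtain ⟨t, ht⟩ := exists_gaussIter_eq_zero r.den (l := r.num) h0 h1 r.pos (by
    exact_mod_cast r.den_mul_eq_num)
  have := quot_eq_zero_of_gaussIter ht (m + t)
  have h2 := h t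
  rw [show m + 2 * t = t + (m + t) by ring] at h2
  omega

theorem IsAdmissible.isPreadmissible {α : ℝ} {d : ℕ → ℕ} (h0 : 0 ≤ α) (h1 : α < 1)
    (h : IsAdmissible α d)
    (hs : Summable fun i => (d i : ℝ) * ((convDen α i : ℝ) * α - (convNum α i : ℝ))) :
    IsPreadmissible α d where
  le_quot := h.le_quot
  eq_zero i hi := by
    rcases h.eq_zero _ hi with h2 | ⟨k, hk, h2⟩
    · exact .inl h2
    · obtain rfl : i = k := by omega
      exact .inr h2
  not_tail := fun ⟨m, hm⟩ =>
    h.not_tail (irrational_of_quot_pos h0 h1 fun t => (hm t).1) ⟨m, fun t => (hm t).2⟩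
  summable := hs

/-- The condition on zeros includes the first digit, which cannot be 0 unless the sequence is null.
So no correction by one is needed at the start of the recursion. -/
theorem IsAdmissible.realVal_nonneg {α : ℝ} {d : ℕ → ℕ} (h0 : 0 ≤ α) (h1 : α < 1)
    (h : IsAdmissible α d) (hd : IsPreadmissible α d) : 0 ≤ realVal α d := by
  by_contra hc
  obtain ⟨h2, h3⟩ := (hd.realVal_neg_iff h0 h1).1 (not_le.1 hc)
  rcases h.eq_zero 0 h2 with h4 | ⟨k, hk, _⟩
  · exact h3 fun i => h4 i i.zero_le
  · omega

theorem seqLength_spec (d : ℕ → ℕ) (i : ℕ) (h : seqLength d ≤ i) : d i = 0 := by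
  have : seqLength d ∈ {m : ℕ∞ | ∀ i : ℕ, m ≤ (i : ℕ∞) → d i = 0} :=
    csInf_mem ⟨⊤, fun i hi => absurd hi (by simp)⟩
  exact this i h

theorem not_isNull_shift_of_lt_seqLength {d : ℕ → ℕ} {j : ℕ} (h : (j : ℕ∞) < seqLength d) :
    ¬ IsNull (shift j d) := by
  intro hn
  refine h.not_ge (sInf_le fun i hi => ?_)
  have hji : j ≤ i := by exact_mod_cast hi
  have := hn (i - j)
  rwa [shift_apply, show j + (i - j) = i by omega] at this

theorem count_eq_signedCount {α β : ℝ} (hβ0 : 0 ≤ β) (hβ1 : β < 1) (ν : ℕ) :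
    (count α β ν : ℤ) = signedCount α β ν := by
  classical
  have hset : {k : ℕ | k < ν ∧ Int.fract ((k : ℝ) * α) < β}
      = ((Finset.range ν).filter fun k => Int.fract ((k : ℝ) * α) < β : Finset ℕ) := by
    ext k
    simp
  rw [count, hset, Set.ncard_coe_finset, Finset.card_filter, signedCount]
  push_cast
  refine Finset.sum_congr rfl fun k _ => ?_
  have e := Int.floor_add_fract ((k : ℝ) * α)
  have f0 := Int.fract_nonneg ((k : ℝ) * α)
  have f1 := Int.fract_lt_one ((k : ℝ) * α)
  have : ⌊(k : ℝ) * α - β⌋ = ⌊(k : ℝ) * α⌋ + ⌊Int.fract ((k : ℝ) * α) - β⌋ := by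
    rw [← Int.floor_intCast_add, ← add_sub_assoc, e]
  rw [this]
  split_ifs with h
  · have : ⌊Int.fract ((k : ℝ) * α) - β⌋ = -1 := by
      rw [Int.floor_eq_iff]; push_cast; constructor <;> linarith
    rw [this]; ring
  · have : ⌊Int.fract ((k : ℝ) * α) - β⌋ = 0 := by
      rw [Int.floor_eq_zero_iff]; constructor <;> linarith
    rw [this]; ring

end AlphaNumeration

theorem proposition11 (α β : ℝ) (hα0 : 0 ≤ α) (hα1 : α < 1) (hβ0 : 0 ≤ β) (hβ1 : β < 1)
    (ν : ℕ) (hν : 0 < ν) (n b : ℕ → ℕ)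
    (hn : AlphaNumeration.IsIntNumeration α n ν)
    (hb : AlphaNumeration.IsRealNumeration α b β)
    (s : ℕ)
    (hs : (s : ℕ∞) = min (AlphaNumeration.seqLength n) (AlphaNumeration.seqLength b)) :
    (AlphaNumeration.count α β ν : ℤ) =
      ∑ i ∈ Finset.range s, (-1 : ℤ) ^ i *
        ((b i : ℤ) * AlphaNumeration.nuSeq α n ν (i + 1) + AlphaNumeration.tau b n i
          + AlphaNumeration.eps b n i - AlphaNumeration.eps' b n i) := by
  open AlphaNumeration in
  obtain ⟨hna, L, hL, hνL⟩ := hn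
  obtain ⟨hba, hsum⟩ := hb
  have hn' := hna.isPreadmissible hα0 hα1 (summable_of_eq_zero α hL)
  have hb' := hba.isPreadmissible hα0 hα1 hsum.summable
  have hn0 : ¬ realVal α n < 0 := (hna.realVal_nonneg hα0 hα1 hn').not_gt
  have hN : intVal α n = ν := by rw [intVal_eq_sum α hL, hνL]
  have hβ : realVal α b = β := hsum.tsum_eq
  have key := digit_sum_eq_signedCount s hα0 hα1 hb' hn' hL
    (by
      rcases min_choice (seqLength n) (seqLength b) with h | h
      · exact .inl fun i => seqLength_spec n _ (by rw [← h, ← hs]; push_cast; exact le_self_add)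
      · exact .inr fun i => seqLength_spec b _ (by rw [← h, ← hs]; push_cast; exact le_self_add))
    (fun j hj => by
      have hj' : (j : ℕ∞) < min (seqLength n) (seqLength b) := by
        rw [← hs]; exact_mod_cast hj
      exact ⟨not_isNull_shift_of_lt_seqLength (hj'.trans_le (min_le_left _ _)),
        not_isNull_shift_of_lt_seqLength (hj'.trans_le (min_le_right _ _))⟩)
  rw [if_neg hn0, if_neg (fun h => hn0 h.1), add_zero, hN, hβ] at key
  rw [key, count_eq_signedCount hβ0 hβ1]
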